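/- For $|q|<1$ write $(a;q)_\infty=\prod_{k\ge 0}(1-aq^k)$, $(a_1,\dots,a_r;q)_\infty=\prod_{i}(a_i;q)_\infty$ and $E_j=(q^j;q^j)_\infty$, and let $$f(a,b)=\sum_{k=-\infty}^{\infty}a^{k(k+1)/2}b^{k(k-1)/2},\qquad \varphi(q)=f(q,q),\qquad \psi(q)=f(q,q^3).$$ For coprime integers $1\le j\le p-1$ define the integers $a_{j,p}(n)$ by the expansion, in powers of $q$, of Chan's Appell–Lerch sum $$\sum_{n=0}^{\infty} a_{j,p}(n)q^n = \frac{1}{(q^j, q^{p-j}, q^p; q^p)_{\infty}} \sum_{n=-\infty}^{\infty} \frac{(-1)^n q^{pn(n+1)/2+jn+j}}{1 - q^{pn+j}}.$$ Then, for every integer $n\ge 0$, $$a_{1,10}(10n+5)\equiv 0 \pmod 5 .$$ Moreover, the odd-indexed coefficients have the generating function $$2\sum_{n=0}^{\infty}a_{1,10}(2n+1)q^n=\frac{E_1^2}{E_5}+6q\,\frac{E_2E_{10}^3}{E_1E_5^2}+\frac{E_2^2}{E_1^2E_5}\Bigl(\varphi(q^2)\varphi(q^{10})-4q^3\psi(q^4)\psi(q^{20})\Bigr).$$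 -/

import Mathlib

open PowerSeries
open scoped PowerSeries.WithPiTopology

/-! All series are formal series in `q = X` with integer coefficients; infinite products and sums
of power series converge coefficientwise (`ℤ` is discrete). Division is multiplication by
`Ring.inverse`, which is the genuine inverse of every unit. -/

noncomputable section

/-- `(a; q)_∞ = ∏_{k ≥ 0} (1 - a q^k)`. -/
def qPoch (a q : ℤ⟦X⟧) : ℤ⟦X⟧ := ∏' k : ℕ, (1 - a * q ^ k)

/-- `E_j = (q^j; q^j)_∞`. -/
def eulerE (j : ℕ) : ℤ⟦X⟧ := qPoch (X ^ j) (X ^ j)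

/-- Ramanujan's general theta function `f(a, b) = ∑_{k ∈ ℤ} a^{k(k+1)/2} b^{k(k-1)/2}`
(both exponents are nonnegative integers). -/
def ramanujanTheta (a b : ℤ⟦X⟧) : ℤ⟦X⟧ :=
  ∑' k : ℤ, a ^ (k * (k + 1) / 2).toNat * b ^ (k * (k - 1) / 2).toNat

/-- `φ(q) = f(q, q)`. -/
def thetaPhi (q : ℤ⟦X⟧) : ℤ⟦X⟧ := ramanujanTheta q q

/-- `ψ(q) = f(q, q³)`. -/
def thetaPsi (q : ℤ⟦X⟧) : ℤ⟦X⟧ := ramanujanTheta q (q ^ 3)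

/-- The term `(-1)^n q^{pn(n+1)/2 + jn + j} / (1 - q^{pn+j})`, as a Laurent series in `q`. For
`pn + j < 0` this is its expansion in `0 < |q| < 1`, since `1 - q^{pn+j}` is a unit. -/
def appellLerchTerm (j p : ℕ) (n : ℤ) : LaurentSeries ℤ :=
  HahnSeries.single (p * (n * (n + 1) / 2) + j * n + j) (n.negOnePow : ℤ) *
    Ring.inverse (1 - HahnSeries.single (p * n + j) (1 : ℤ))

/-- `∑_{n ∈ ℤ} (-1)^n q^{pn(n+1)/2 + jn + j} / (1 - q^{pn+j})`, summed coefficientwise. For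
`0 < j < p` only finitely many terms contribute to each coefficient and no negative power
of `q` occurs, see `appellLerchTerm_coeff_eq_zero`. -/
def appellLerchSum (j p : ℕ) : ℤ⟦X⟧ :=
  PowerSeries.mk fun k => ∑ᶠ n : ℤ, (appellLerchTerm j p n).coeff (k : ℤ)

/-- The generating function of `a_{j,p}`, for `0 < j < p`. -/
def appellLerchGen (j p : ℕ) : ℤ⟦X⟧ :=
  Ring.inverse (qPoch (X ^ j) (X ^ p) * qPoch (X ^ (p - j)) (X ^ p) * qPoch (X ^ p) (X ^ p)) *
    appellLerchSum j p

/-- The coefficients `a_{j,p}(n)` of Chan's Appell–Lerch sum. -/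
def appellLerchA (j p n : ℕ) : ℤ := PowerSeries.coeff n (appellLerchGen j p)

/-- For an exponent `m ≠ 0`, `1 - q^m` is invertible among Laurent series. -/
theorem isUnit_one_sub_single {m : ℤ} (hm : m ≠ 0) :
    IsUnit (1 - HahnSeries.single m (1 : ℤ) : LaurentSeries ℤ) ∧
      (1 - HahnSeries.single m (1 : ℤ) : LaurentSeries ℤ).order = min 0 m := by
  have pos : ∀ m : ℤ, 0 < m → IsUnit (1 - HahnSeries.single m (1 : ℤ) : LaurentSeries ℤ) ∧
      (1 - HahnSeries.single m (1 : ℤ) : LaurentSeries ℤ).order = 0 := by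
    intro m hm
    have h0 : (1 - HahnSeries.single m (1 : ℤ) : LaurentSeries ℤ).coeff 0 = 1 := by
      simp [HahnSeries.coeff_single_of_ne hm.ne]
    have hne : (1 - HahnSeries.single m (1 : ℤ) : LaurentSeries ℤ) ≠ 0 := by
      intro h; rw [h] at h0; simp at h0
    have ho : (1 - HahnSeries.single m (1 : ℤ) : LaurentSeries ℤ).order = 0 := by
      apply le_antisymm
      · exact HahnSeries.order_le_of_coeff_ne_zero (by rw [h0]; exact one_ne_zero)
      · by_contra hlt
        push Not at hlt
        apply mt HahnSeries.coeff_order_eq_zero.mp hne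
        rw [HahnSeries.coeff_sub, HahnSeries.coeff_one, if_neg hlt.ne,
          HahnSeries.coeff_single_of_ne (by lia), sub_zero]
    refine ⟨?_, ho⟩
    rw [HahnSeries.isUnit_iff, HahnSeries.leadingCoeff_eq, ho, h0]
    exact isUnit_one
  rcases lt_or_gt_of_ne hm with h | h
  · obtain ⟨hu, ho⟩ := pos (-m) (by lia)
    have key : (1 - HahnSeries.single m (1 : ℤ) : LaurentSeries ℤ) =
        HahnSeries.single m (-1 : ℤ) * (1 - HahnSeries.single (-m) (1 : ℤ)) := by
      rw [mul_sub, mul_one, HahnSeries.single_mul_single]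
      simp only [add_neg_cancel, mul_one, HahnSeries.single_neg]
      rw [show (HahnSeries.single (0 : ℤ) (1 : ℤ) : LaurentSeries ℤ) = 1 from rfl]
      ring
    have hs : IsUnit (HahnSeries.single m (-1 : ℤ) : LaurentSeries ℤ) := by
      rw [HahnSeries.isUnit_iff, HahnSeries.leadingCoeff_of_single]
      exact isUnit_one.neg
    refine ⟨key ▸ hs.mul hu, ?_⟩
    rw [key, HahnSeries.order_mul hs.ne_zero hu.ne_zero, ho,
      HahnSeries.order_single (by norm_num)]
    lia
  · obtain ⟨hu, ho⟩ := pos m h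
    exact ⟨hu, by rw [ho]; lia⟩

/-- For `0 < j < p` the `n`-th term only involves powers `q^k` with `k ≥ |n|`. -/
theorem appellLerchTerm_coeff_eq_zero {j p : ℕ} (hj : 0 < j) (hp : j < p) {n k : ℤ}
    (hk : k < |n|) : (appellLerchTerm j p n).coeff k = 0 := by
  have hm : (p * n + j : ℤ) ≠ 0 := by
    intro h
    rcases lt_or_ge n 0 with hn | hn
    · nlinarith
    · nlinarith
  obtain ⟨hu, ho⟩ := isUnit_one_sub_single hm
  have hi : IsUnit (Ring.inverse (1 - HahnSeries.single (p * n + j : ℤ) (1 : ℤ)) :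
      LaurentSeries ℤ) := hu.ringInverse
  have hio := HahnSeries.order_mul hu.ne_zero hi.ne_zero
  rw [Ring.mul_inverse_cancel _ hu, HahnSeries.order_one, ho] at hio
  have hc : ((n.negOnePow : ℤˣ) : ℤ) ≠ 0 := n.negOnePow.isUnit.ne_zero
  apply HahnSeries.coeff_eq_zero_of_lt_order
  rw [appellLerchTerm, HahnSeries.order_mul (HahnSeries.single_ne_zero hc) hi.ne_zero,
    HahnSeries.order_single hc]
  refine hk.trans_le ?_
  have he : 2 * (n * (n + 1) / 2) = n * (n + 1) :=
    Int.mul_ediv_cancel' (Int.even_mul_succ_self n).two_dvd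
  have hj' : (1 : ℤ) ≤ j := by exact_mod_cast hj
  have hp' : (j : ℤ) + 1 ≤ p := by exact_mod_cast hp
  rcases lt_or_ge n 0 with hn | hn
  · have : (p * n + j : ℤ) < 0 := by nlinarith
    rw [abs_of_neg hn]
    rw [min_eq_right this.le] at hio
    have h1 : 0 ≤ (p : ℤ) * (n * (n + 1) - 2 * n - 2 * (-n)) := by nlinarith
    nlinarith [mul_nonneg (show (0 : ℤ) ≤ p - j - 1 by lia) (show 0 ≤ -n by lia),
      mul_nonneg (show (0 : ℤ) ≤ p by lia) (show (0 : ℤ) ≤ n * (n + 1) by nlinarith)]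
  · have : (0 : ℤ) ≤ p * n + j := by positivity
    rw [abs_of_nonneg hn]
    rw [min_eq_left this] at hio
    nlinarith [mul_nonneg (show (0 : ℤ) ≤ p by lia) (show (0 : ℤ) ≤ n * (n + 1) by nlinarith)]

end

/-! Write a, b, c, d for (q^i, q^{10-i}; q^10)_∞ with i = 1, 2, 3, 4, and e = (q^5; q^10)_∞, J =
E_10, U = ∑ a_{1,10}(2n+1) q^n. Both claims follow from the product formula U = bJ/(a³de)
(`oddPart_mul_tenPair`).

Product formula. Multiply the numerator and denominator of the Appell–Lerch series by f(q, q^9). The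
denominator becomes f(-q^2, -q^18) φ(-q^10), an even series, so only the odd part of the new
numerator matters. Expanding geometric series turns that numerator into a signed triple sum. A
sign-reversing involution reduces its odd part to f(q, q^4) Λ, where Λ = ∑ (-1)^n q^{5n(n+1)}/(1 -
q^{10n+1}) (`latticeSum_oddExp`). Finally Λ f(-q, -q^9) = E_10^3 (`latticeSum_lambda_mul_theta`), by
a telescoping argument and Jacobi's formula for the cube of the Euler product.

Generating function. Cutting ℤ² into cosets of sublattices gives identities between products of two
theta functions. The triple product turns these into polynomial relations among a, b, c, d, e. The
combination of φ and ψ is evaluated through its square, by Brahmagupta's identity for x² - 4qy²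
(`thetaPhi_mul_sub_thetaPsi_mul`). After that the claim is a linear combination of relations.

Congruence. Work modulo 5 with D = q d/dq, which kills every series in q^5, hence e and J. Put k =
qab/(cd) and R = ad/(bc). Up to powers of q, R is the Rogers–Ramanujan continued fraction, and q R^5
= k((1-k)/(1+k))². Since D(R^5) = 0 modulo 5, this yields a first-order differential equation for k.
The product formula reads U = J e^{-7} q² k^{-2} (1+k)² (1-k), and the differential equation gives
an explicit G with U = DG - 2G (`exists_eulerDerivation_sub`). The operator D - 2 multiplies the
coefficient of q^{5n+2} by 5n, so that coefficient of U, which is a_{1,10}(10n+5), vanishes modulo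
5. -/

noncomputable section

/-! ### Sums of monomials over lattices -/

/-- The power series `∑ c(i) X^{w(i)}`. -/
def latticeSum {ι : Type*} (w c : ι → ℤ) : ℤ⟦X⟧ := ∑' i, C (c i) * X ^ (w i).toNat

/-- Each power of `X` occurs finitely often in `∑ c(i) X^{w(i)}`. -/
def LocFin {ι : Type*} (w c : ι → ℤ) : Prop := ∀ d : ℤ, {i | c i ≠ 0 ∧ w i ≤ d}.Finite

section
variable {ι κ : Type*} {w w' c c' : ι → ℤ} {v b : κ → ℤ}

theorem LocFin.summable (h : LocFin w c) :
    Summable fun i => (C (c i) * X ^ (w i).toNat : ℤ⟦X⟧) := by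
  rw [PowerSeries.WithPiTopology.summable_iff_summable_coeff]
  intro d
  apply summable_of_hasFiniteSupport
  refine (h d).subset fun i hi => ?_
  rw [Function.mem_support, coeff_C_mul, coeff_X_pow] at hi
  by_cases hd : d = (w i).toNat
  · exact ⟨fun h0 => hi (by simp [h0]), by lia⟩
  · simp [hd] at hi

theorem LocFin.of_support (h : LocFin w c) (hc : ∀ i, c' i ≠ 0 → c i ≠ 0) : LocFin w c' :=
  fun d => (h d).subset fun i hi => ⟨hc i hi.1, hi.2⟩

theorem LocFin.comp_injective (h : LocFin w c) {g : κ → ι} (hg : Function.Injective g) :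
    LocFin (fun k => w (g k)) (fun k => c (g k)) :=
  fun d => (h d).preimage hg.injOn

theorem LocFin.add_const (h : LocFin w c) (k : ℤ) : LocFin (fun i => w i + k) c :=
  fun d => (h (d - k)).subset fun i hi => ⟨hi.1, by linarith [hi.2]⟩

theorem LocFin.prod (h : LocFin w c) (hv : LocFin v b) (h0 : ∀ i, c i ≠ 0 → 0 ≤ w i)
    (hv0 : ∀ k, b k ≠ 0 → 0 ≤ v k) :
    LocFin (fun x : ι × κ => w x.1 + v x.2) (fun x => c x.1 * b x.2) := by
  intro d
  refine ((h d).prod (hv d)).subset ?_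
  rintro ⟨i, k⟩ ⟨h1, h2⟩
  have hi := left_ne_zero_of_mul h1
  have hk := right_ne_zero_of_mul h1
  have := h0 i hi
  have := hv0 k hk
  simp only [Set.mem_prod, Set.mem_ofPred_eq] at h2 ⊢
  exact ⟨⟨hi, by linarith⟩, hk, by linarith⟩

theorem LocFin.of_bound {w c : ℤ → ℤ} (K : ℤ) (h : ∀ i, c i ≠ 0 → |i| ≤ w i + K) :
    LocFin w c := by
  intro d
  refine (Set.finite_Icc (-(d + K)) (d + K)).subset fun i hi => ?_
  have := h i hi.1
  exact abs_le.mp (by linarith [hi.2])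

theorem LocFin.of_bound₂ {w c : ℤ × ℤ → ℤ} (K : ℤ)
    (h : ∀ i j, c (i, j) ≠ 0 → |i| ≤ w (i, j) + K ∧ |j| ≤ w (i, j) + K) : LocFin w c := by
  intro d
  refine ((Set.finite_Icc (-(d + K)) (d + K)).prod (Set.finite_Icc (-(d + K)) (d + K))).subset ?_
  rintro ⟨i, j⟩ hi
  have := h i j hi.1
  have h2 := hi.2
  exact ⟨abs_le.mp (by linarith), abs_le.mp (by linarith)⟩

theorem latticeSum_congr (hc : ∀ i, c i = c' i) (hw : ∀ i, c i ≠ 0 → w i = w' i) :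
    latticeSum w c = latticeSum w' c' := by
  refine tsum_congr fun i => ?_
  by_cases h : c i = 0
  · simp [h, ← hc i]
  · rw [hc i, hw i h]

theorem latticeSum_equiv (e : κ ≃ ι) (w c : ι → ℤ) :
    latticeSum (fun k => w (e k)) (fun k => c (e k)) = latticeSum w c :=
  e.tsum_eq fun i => (C (c i) * X ^ (w i).toNat : ℤ⟦X⟧)

theorem latticeSum_add (h : LocFin w c) (h' : LocFin w c') :
    latticeSum w (fun i => c i + c' i) = latticeSum w c + latticeSum w c' := by
  rw [latticeSum, latticeSum, latticeSum, ← h.summable.tsum_add h'.summable]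
  exact tsum_congr fun i => by rw [map_add, add_mul]

theorem latticeSum_neg (w c : ι → ℤ) :
    latticeSum w (fun i => -c i) = -latticeSum w c := by
  rw [latticeSum, latticeSum, ← tsum_neg]
  exact tsum_congr fun i => by rw [map_neg, neg_mul]

theorem latticeSum_sub (h : LocFin w c) (h' : LocFin w c') :
    latticeSum w (fun i => c i - c' i) = latticeSum w c - latticeSum w c' := by
  rw [latticeSum, latticeSum, latticeSum, ← h.summable.tsum_sub h'.summable]
  exact tsum_congr fun i => by rw [map_sub, sub_mul]

/-- The exponent must be nonnegative wherever the coefficient is nonzero: `toNat` would otherwise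
truncate it before the shift. -/
theorem X_pow_mul_latticeSum (k : ℕ) (h : LocFin w c) (h0 : ∀ i, c i ≠ 0 → 0 ≤ w i) :
    X ^ k * latticeSum w c = latticeSum (fun i => w i + k) c := by
  rw [latticeSum, latticeSum, ← h.summable.tsum_mul_left]
  refine tsum_congr fun i => ?_
  by_cases hi : c i = 0
  · simp [hi]
  · rw [show (w i + k).toNat = k + (w i).toNat by have := h0 i hi; lia, pow_add]
    ring

instance instT3SpaceIntPowerSeries : T3Space ℤ⟦X⟧ := by
  have : @T3Space ℤ⟦X⟧ (UniformSpace.toTopologicalSpace) := inferInstance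
  exact this

theorem latticeSum_mul (h : LocFin w c) (hv : LocFin v b) (h0 : ∀ i, c i ≠ 0 → 0 ≤ w i)
    (hv0 : ∀ k, b k ≠ 0 → 0 ≤ v k) :
    latticeSum w c * latticeSum v b =
      latticeSum (fun x : ι × κ => w x.1 + v x.2) (fun x => c x.1 * b x.2) := by
  have key : ∀ x : ι × κ, (C (c x.1) * X ^ (w x.1).toNat * (C (b x.2) * X ^ (v x.2).toNat) : ℤ⟦X⟧)
      = C (c x.1 * b x.2) * X ^ (w x.1 + v x.2).toNat := by
    rintro ⟨i, k⟩
    by_cases hi : c i = 0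
    · simp [hi]
    by_cases hk : b k = 0
    · simp [hk]
    rw [show (w i + v k).toNat = (w i).toNat + (v k).toNat by
      have := h0 i hi; have := hv0 k hk; lia, pow_add, map_mul]
    ring
  have hs := (h.prod hv h0 hv0).summable
  simp only [← key] at hs
  rw [latticeSum, latticeSum, latticeSum, h.summable.tsum_mul_tsum hv.summable hs]
  exact tsum_congr key

/-- Cancellation principle: reindexing by σ gives S = -S, and integer coefficients have no
2-torsion. The permutation σ need not be an involution. -/
theorem latticeSum_eq_zero (σ : ι ≃ ι) (hw : ∀ i, c i ≠ 0 → w (σ i) = w i)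
    (hc : ∀ i, c (σ i) = -c i) : latticeSum w c = 0 := by
  have h : latticeSum w c = -latticeSum w c := by
    conv_lhs => rw [← latticeSum_equiv σ w c]
    rw [← latticeSum_neg]
    exact latticeSum_congr hc fun i hi => hw i fun h0 => hi (by rw [hc, h0, neg_zero])
  ext d
  have := congrArg (coeff d) h
  rw [map_neg] at this
  rw [map_zero]
  lia

theorem coeff_latticeSum (h : LocFin w c) (d : ℕ) :
    coeff d (latticeSum w c) = ∑' i, if d = (w i).toNat then c i else 0 := by
  have := (PowerSeries.WithPiTopology.hasSum_iff_hasSum_coeff ℤ).mp h.summable.hasSum d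
  rw [latticeSum, ← this.tsum_eq]
  exact tsum_congr fun i => by rw [coeff_C_mul, coeff_X_pow]; simp

end

/-! ### The Jacobi triple product -/

section JacobiTriple
open Filter Topology

variable {R : Type*} [CommRing R]

/-- The summand `a^{k(k+1)/2} b^{k(k-1)/2}` of Ramanujan's theta function. -/
def thetaMonomial {A : Type*} [CommRing A] (a b : A) (k : ℤ) : A :=
  a ^ (k * (k + 1) / 2).toNat * b ^ (k * (k - 1) / 2).toNat

theorem two_mul_tri (k : ℤ) : 2 * (k * (k + 1) / 2) = k * (k + 1) :=
  Int.mul_ediv_cancel' (Int.even_mul_succ_self k).two_dvd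

theorem two_mul_tri' (k : ℤ) : 2 * (k * (k - 1) / 2) = k * (k - 1) :=
  Int.mul_ediv_cancel' (Int.even_mul_pred_self k).two_dvd

theorem tri_nonneg (k : ℤ) : 0 ≤ k * (k + 1) / 2 := by
  have := two_mul_tri k
  rcases le_or_gt 0 k with h | h <;> nlinarith

theorem tri_nonneg' (k : ℤ) : 0 ≤ k * (k - 1) / 2 := by
  have := two_mul_tri' k
  rcases le_or_gt 1 k with h | h <;> nlinarith

theorem thetaMonomial_neg {A : Type*} [CommRing A] (a b : A) (k : ℤ) :
    thetaMonomial a b (-k) = thetaMonomial b a k := by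
  rw [thetaMonomial, thetaMonomial, mul_comm, show -k * (-k - 1) = k * (k + 1) by ring,
    show -k * (-k + 1) = k * (k - 1) by ring]

theorem thetaMonomial_succ {A : Type*} [CommRing A] (a b : A) {k : ℤ} (hk : 0 ≤ k) :
    thetaMonomial a b (k + 1) = a * (a * b) ^ k.toNat * thetaMonomial a b k := by
  have h1 := two_mul_tri k
  have h2 := two_mul_tri' k
  have h3 := two_mul_tri (k + 1)
  have h4 := two_mul_tri' (k + 1)
  have h5 := tri_nonneg k
  have h6 := tri_nonneg' k
  rw [thetaMonomial, thetaMonomial,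
    show ((k + 1) * (k + 1 + 1) / 2).toNat = 1 + k.toNat + (k * (k + 1) / 2).toNat by
      have : (k + 1) * (k + 1 + 1) / 2 = 1 + k + k * (k + 1) / 2 := by linarith
      lia,
    show ((k + 1) * (k + 1 - 1) / 2).toNat = k.toNat + (k * (k - 1) / 2).toNat by
      have : (k + 1) * (k + 1 - 1) / 2 = k + k * (k - 1) / 2 := by linarith
      lia]
  ring

/-- A division-free form of t_{k+1} = a(ab)^k t_k, valid for k of either sign as long as |k| ≤ n. -/
theorem mul_pow_mul_thetaMonomial {A : Type*} [CommRing A] (a b : A) {n k : ℤ}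
    (h1 : 0 ≤ n - k) (h2 : 0 ≤ n + k) :
    a * (a * b) ^ n.toNat * thetaMonomial a b k =
      (a * b) ^ (n - k).toNat * thetaMonomial a b (k + 1) := by
  rcases le_or_gt 0 k with hk | hk
  · rw [thetaMonomial_succ a b hk, show n.toNat = (n - k).toNat + k.toNat by lia]
    ring
  · obtain ⟨j, rfl⟩ : ∃ j : ℤ, k = -(j + 1) := ⟨-k - 1, by ring⟩
    rw [show -(j + 1) + 1 = -j by ring, thetaMonomial_neg, thetaMonomial_neg,
      thetaMonomial_succ b a (by lia : 0 ≤ j),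
      show (n - -(j + 1)).toNat = n.toNat + j.toNat + 1 by lia]
    ring

theorem mul_pow_mul_thetaMonomial' {A : Type*} [CommRing A] (a b : A) {n k : ℤ}
    (h1 : 0 ≤ n - k) (h2 : 0 ≤ n + k) :
    b * (a * b) ^ n.toNat * thetaMonomial a b k =
      (a * b) ^ (n + k).toNat * thetaMonomial a b (k - 1) := by
  have := mul_pow_mul_thetaMonomial b a (n := n) (k := -k) (by lia) (by lia)
  rw [thetaMonomial_neg, show -k + 1 = -(k - 1) by ring, thetaMonomial_neg, mul_comm b a,
    sub_neg_eq_add] at this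
  exact this

/-- The inverse of `(q; q)_n` for `q = X^s`, extended by zero to negative `n`. -/
def invQFactorial (R : Type*) [CommRing R] (s : ℕ) (n : ℤ) : R⟦X⟧ :=
  if 0 ≤ n then
    ∏ k ∈ Finset.range n.toNat, invOfUnit (1 - (X ^ s : R⟦X⟧) ^ (k + 1)) 1 else 0

theorem one_sub_mul_invOfUnit {s : ℕ} (hs : 1 ≤ s) (k : ℕ) :
    (1 - (X ^ s : R⟦X⟧) ^ (k + 1)) * invOfUnit (1 - (X ^ s : R⟦X⟧) ^ (k + 1)) 1 = 1 := by
  apply mul_invOfUnit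
  have : s ≠ 0 := by lia
  simp [this]

theorem invQFactorial_eq {s : ℕ} (hs : 1 ≤ s) (m : ℤ) :
    invQFactorial R s m = invQFactorial R s (m + 1) * (1 - (X ^ s) ^ (m + 1).toNat) := by
  rcases lt_trichotomy (m + 1) 0 with h | h | h
  · rw [invQFactorial, invQFactorial, if_neg (by lia), if_neg (by lia), zero_mul]
  · rw [h, invQFactorial, if_neg (by lia)]
    simp
  · rw [invQFactorial, invQFactorial, if_pos (by lia), if_pos (by lia),
      show (m + 1).toNat = m.toNat + 1 by lia, Finset.prod_range_succ, mul_assoc,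
      mul_comm (invOfUnit _ _), one_sub_mul_invOfUnit hs, mul_one]

/-- The finite form of the `k`-th coefficient of the triple product. -/
def finiteTripleCoeff (R : Type*) [CommRing R] (s n : ℕ) (k : ℤ) : R⟦X⟧ :=
  (∏ i ∈ Finset.range (2 * n), (1 - (X ^ s : R⟦X⟧) ^ (i + 1))) *
    (invQFactorial R s (n - k) * invQFactorial R s (n + k))

/-- The q-Pascal recursion for the central q-binomial (q;q)_{2n} / ((q;q)_{n-k} (q;q)_{n+k}), with q
= X^s. Extending the inverse factorials by zero makes it hold at the boundary too. -/
theorem finiteTripleCoeff_succ {s : ℕ} (hs : 1 ≤ s) (n : ℕ) (k : ℤ) :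
    finiteTripleCoeff R s (n + 1) k =
      finiteTripleCoeff R s n k * (1 + (X ^ s) ^ (2 * n + 1)) +
      finiteTripleCoeff R s n (k - 1) * (X ^ s) ^ ((n : ℤ) - (k - 1)).toNat +
      finiteTripleCoeff R s n (k + 1) * (X ^ s) ^ ((n : ℤ) + (k + 1)).toNat := by
  simp only [finiteTripleCoeff]
  obtain ⟨m, hm⟩ : ∃ m : ℤ, m = n - k := ⟨_, rfl⟩
  obtain ⟨l, hl⟩ : ∃ l : ℤ, l = n + k := ⟨_, rfl⟩
  rw [show ((n + 1 : ℕ) : ℤ) - k = m + 1 by push_cast; lia,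
    show ((n + 1 : ℕ) : ℤ) + k = l + 1 by push_cast; lia,
    show (n : ℤ) - (k - 1) = m + 1 by lia, show (n : ℤ) + (k - 1) = l - 1 by lia,
    show (n : ℤ) - (k + 1) = m - 1 by lia, show (n : ℤ) + (k + 1) = l + 1 by lia,
    ← hm, ← hl, show 2 * (n + 1) = 2 * n + 1 + 1 by ring, Finset.prod_range_succ,
    Finset.prod_range_succ]
  have em := invQFactorial_eq (R := R) hs m
  have el := invQFactorial_eq (R := R) hs l
  have em' := invQFactorial_eq (R := R) hs (m - 1)
  have el' := invQFactorial_eq (R := R) hs (l - 1)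
  rw [sub_add_cancel] at em' el'
  rw [em', el', em, el]
  by_cases hneg : m + 1 < 0 ∨ l + 1 < 0
  · rcases hneg with h | h
    · rw [show invQFactorial R s (m + 1) = 0 by rw [invQFactorial, if_neg (by lia)]]
      ring
    · rw [show invQFactorial R s (l + 1) = 0 by rw [invQFactorial, if_neg (by lia)]]
      ring
  have hxy : (X ^ s : R⟦X⟧) ^ (m + 1).toNat * (X ^ s) ^ (l + 1).toNat = (X ^ s) ^ (2 * n + 1 + 1) := by
    rw [← pow_add]
    congr 1
    lia
  -- At m = -1 the truncation makes `m.toNat` equal to 0, so the exponents do not match. The factor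
  -- on the left vanishes there and saves the identity.
  have hx : (1 - (X ^ s : R⟦X⟧) ^ (m + 1).toNat) * ((X ^ s) ^ (l + 1).toNat * (X ^ s) ^ m.toNat) =
      (1 - (X ^ s : R⟦X⟧) ^ (m + 1).toNat) * (X ^ s) ^ (2 * n + 1) := by
    by_cases h : m + 1 = 0
    · simp [h]
    · rw [← pow_add (X ^ s : R⟦X⟧) (l + 1).toNat]
      congr 2
      lia
  have hy : (1 - (X ^ s : R⟦X⟧) ^ (l + 1).toNat) * ((X ^ s) ^ (m + 1).toNat * (X ^ s) ^ l.toNat) =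
      (1 - (X ^ s : R⟦X⟧) ^ (l + 1).toNat) * (X ^ s) ^ (2 * n + 1) := by
    by_cases h : l + 1 = 0
    · simp [h]
    · rw [← pow_add (X ^ s : R⟦X⟧) (m + 1).toNat]
      congr 2
      lia
  rw [← hxy]
  generalize (X ^ s : R⟦X⟧) ^ (m + 1).toNat = x at *
  generalize (X ^ s : R⟦X⟧) ^ (l + 1).toNat = y at *
  generalize (X ^ s : R⟦X⟧) ^ m.toNat = x' at *
  generalize (X ^ s : R⟦X⟧) ^ l.toNat = y' at *
  generalize (X ^ s : R⟦X⟧) ^ (2 * n + 1) = P at *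
  linear_combination (∏ i ∈ Finset.range (2 * n), (1 - (X ^ s : R⟦X⟧) ^ (i + 1))) *
    invQFactorial R s (m + 1) * invQFactorial R s (l + 1) * (hx + hy)

theorem finiteTripleCoeff_eq_zero {s n : ℕ} {k : ℤ} (h : (n : ℤ) - k < 0 ∨ (n : ℤ) + k < 0) :
    finiteTripleCoeff R s n k = 0 := by
  rcases h with h | h <;> rw [finiteTripleCoeff, invQFactorial, invQFactorial]
  · rw [if_neg (by lia)]; simp
  · rw [if_neg (c := 0 ≤ (n : ℤ) + k) (by lia)]; simp

theorem X_pow_dvd_X_pow_mul (s k : ℕ) (hs : 1 ≤ s) : (X : R⟦X⟧) ^ k ∣ (X ^ s) ^ k := by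
  rw [← pow_mul]
  exact pow_dvd_pow _ (by nlinarith)

theorem multipliable_one_add_of_X_pow_dvd [TopologicalSpace R] {f : ℕ → R⟦X⟧}
    (h : ∀ k, X ^ k ∣ f k) : Multipliable fun k => 1 + f k := by
  apply PowerSeries.WithPiTopology.multipliable_one_add_of_tendsto_order_atTop_nhds_top
  refine ENat.tendsto_nhds_top_iff_natCast_lt.mpr fun n => Filter.eventually_atTop.mpr ⟨n + 1, ?_⟩
  intro m hm
  have h1 : (m : ℕ∞) ≤ (f m).order :=
    nat_le_order _ _ fun i hi => X_pow_dvd_iff.mp (h m) i hi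
  exact lt_of_lt_of_le (by exact_mod_cast hm) h1

theorem multipliable_one_add_mul_pow [TopologicalSpace R] {s : ℕ} (hs : 1 ≤ s) (a : R⟦X⟧) :
    Multipliable fun k : ℕ => 1 + a * (X ^ s) ^ k :=
  multipliable_one_add_of_X_pow_dvd fun k => (X_pow_dvd_X_pow_mul s k hs).mul_left a

theorem X_pow_dvd_thetaMonomial {s : ℕ} (hs : 1 ≤ s) {a b : R⟦X⟧} (hab : a * b = X ^ s) (d : ℕ)
    {k : ℤ} (hk : (d : ℤ) < |k|) : X ^ d ∣ thetaMonomial a b k := by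
  have key : ∀ {a b : R⟦X⟧}, a * b = X ^ s → ∀ k : ℤ, d < k → X ^ d ∣ thetaMonomial a b k := by
    intro a b hab k hk
    obtain ⟨m, rfl⟩ : ∃ m, k = m + 1 := ⟨k - 1, by ring⟩
    rw [thetaMonomial_succ a b (by lia), hab]
    refine Dvd.dvd.mul_right (Dvd.dvd.mul_left ?_ _) _
    exact (pow_dvd_pow _ (by lia)).trans (X_pow_dvd_X_pow_mul s m.toNat hs)
  rcases lt_abs.mp hk with h | h
  · exact key hab k h
  · rw [← neg_neg k, thetaMonomial_neg]
    exact key (by rw [mul_comm, hab]) (-k) h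

theorem multipliable_one_sub_pow_succ [TopologicalSpace R] {s : ℕ} (hs : 1 ≤ s) :
    Multipliable fun k : ℕ => 1 - (X ^ s : R⟦X⟧) ^ (k + 1) := by
  refine (multipliable_one_add_mul_pow hs (-(X ^ s))).congr fun k => ?_
  ring

variable [TopologicalSpace R] [DiscreteTopology R]

/-- Passing from n to n + 1 multiplies by (1 + aq^n)(1 + bq^n) = 1 + q^{2n+1} + aq^n + bq^n, because
ab = q = X^s. These terms are those of `finiteTripleCoeff_succ`. -/
theorem hasSum_finite_triple {s : ℕ} (hs : 1 ≤ s) {a b : R⟦X⟧} (hab : a * b = X ^ s) (n : ℕ) :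
    HasSum (fun k : ℤ => finiteTripleCoeff R s n k * thetaMonomial a b k)
      (∏ k ∈ Finset.range n, ((1 + a * (X ^ s) ^ k) * (1 + b * (X ^ s) ^ k))) := by
  induction n with
  | zero =>
    have : (∏ k ∈ Finset.range 0, ((1 + a * (X ^ s) ^ k) * (1 + b * (X ^ s) ^ k))) =
        finiteTripleCoeff R s 0 0 * thetaMonomial a b 0 := by
      simp [finiteTripleCoeff, thetaMonomial, invQFactorial]
    rw [this]
    apply hasSum_single
    intro k hk
    rw [finiteTripleCoeff_eq_zero (by lia), zero_mul]
  | succ n ih =>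
    rw [Finset.prod_range_succ]
    have hA := (Equiv.subRight (1 : ℤ)).hasSum_iff.mpr (ih.mul_right (a * (X ^ s) ^ n))
    have hB := (Equiv.addRight (1 : ℤ)).hasSum_iff.mpr (ih.mul_right (b * (X ^ s) ^ n))
    have h := ((ih.mul_right (1 + (X ^ s) ^ (2 * n + 1))).add hA).add hB
    have hprod : (1 + a * (X ^ s) ^ n) * (1 + b * (X ^ s) ^ n) =
        1 + (X ^ s) ^ (2 * n + 1) + a * (X ^ s) ^ n + b * (X ^ s) ^ n := by
      rw [show (X ^ s : R⟦X⟧) ^ (2 * n + 1) = (a * b) * ((X ^ s) ^ n * (X ^ s) ^ n) by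
        rw [hab]; ring]
      ring
    rw [hprod, mul_add, mul_add]
    refine Eq.mpr (congrArg (fun f : ℤ → R⟦X⟧ => HasSum f _) (funext fun k => ?_)) h
    simp only [Function.comp_apply, Equiv.subRight_apply, Equiv.coe_addRight]
    rw [finiteTripleCoeff_succ hs]
    have e1 : finiteTripleCoeff R s n (k - 1) * (X ^ s) ^ ((n : ℤ) - (k - 1)).toNat *
        thetaMonomial a b k = finiteTripleCoeff R s n (k - 1) * thetaMonomial a b (k - 1) *
          (a * (X ^ s) ^ n) := by
      by_cases hn : (n : ℤ) - (k - 1) < 0 ∨ (n : ℤ) + (k - 1) < 0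
      · rw [finiteTripleCoeff_eq_zero hn]; ring
      · have := mul_pow_mul_thetaMonomial a b (n := n) (k := k - 1) (by lia) (by lia)
        rw [hab, sub_add_cancel, Int.toNat_natCast] at this
        rw [mul_assoc, ← this]
        ring
    have e2 : finiteTripleCoeff R s n (k + 1) * (X ^ s) ^ ((n : ℤ) + (k + 1)).toNat *
        thetaMonomial a b k = finiteTripleCoeff R s n (k + 1) * thetaMonomial a b (k + 1) *
          (b * (X ^ s) ^ n) := by
      by_cases hn : (n : ℤ) - (k + 1) < 0 ∨ (n : ℤ) + (k + 1) < 0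
      · rw [finiteTripleCoeff_eq_zero hn]; ring
      · have := mul_pow_mul_thetaMonomial' a b (n := n) (k := k + 1) (by lia) (by lia)
        rw [hab, add_sub_cancel_right, Int.toNat_natCast] at this
        rw [mul_assoc, ← this]
        ring
    rw [← e1, ← e2]
    ring

theorem tendsto_invQFactorial {s : ℕ} (hs : 1 ≤ s) :
    ∃ u : R⟦X⟧, Tendsto (fun n : ℕ => invQFactorial R s n) atTop (𝓝 u) ∧
      u * ∏' k : ℕ, (1 - (X ^ s : R⟦X⟧) ^ (k + 1)) = 1 := by
  have hm : Multipliable fun k : ℕ => invOfUnit (1 - (X ^ s : R⟦X⟧) ^ (k + 1)) 1 := by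
    have h := multipliable_one_add_of_X_pow_dvd
      (f := fun k => (X ^ s : R⟦X⟧) ^ (k + 1) * invOfUnit (1 - (X ^ s : R⟦X⟧) ^ (k + 1)) 1)
      fun k => Dvd.dvd.mul_right
        ((pow_dvd_pow _ (by lia)).trans (X_pow_dvd_X_pow_mul s (k + 1) hs)) _
    refine h.congr fun k => ?_
    linear_combination -one_sub_mul_invOfUnit (R := R) hs k
  refine ⟨∏' k : ℕ, invOfUnit (1 - (X ^ s : R⟦X⟧) ^ (k + 1)) 1, ?_, ?_⟩
  · refine hm.hasProd.tendsto_prod_nat.congr fun n => ?_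
    simp [invQFactorial]
  · rw [← hm.tprod_mul (multipliable_one_sub_pow_succ hs)]
    simp_rw [mul_comm (invOfUnit _ _), one_sub_mul_invOfUnit hs]
    exact tprod_one

/-- Let n → ∞ in the finite form: every coefficient tends to u = 1/(q;q)_∞. Only ab = X^s is
required, and the base ring is arbitrary, so that dual numbers and a factor b with nonzero constant
term are allowed later. -/
theorem jacobi_triple {s : ℕ} (hs : 1 ≤ s) {a b : R⟦X⟧} (hab : a * b = X ^ s) :
    HasSum (thetaMonomial a b)
      ((∏' k : ℕ, (1 + a * (X ^ s) ^ k)) * (∏' k : ℕ, (1 + b * (X ^ s) ^ k)) *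
        ∏' k : ℕ, (1 - (X ^ s : R⟦X⟧) ^ (k + 1))) := by
  obtain ⟨u, hu, hu1⟩ := tendsto_invQFactorial (R := R) hs
  have hcoeff : ∀ k : ℤ, Tendsto (fun n => finiteTripleCoeff R s n k) atTop (𝓝 u) := by
    intro k
    have h2n : Tendsto (fun n : ℕ => 2 * n) atTop atTop :=
      tendsto_atTop_mono (f := fun n => n) (fun n => by lia) tendsto_id
    have h1 := (multipliable_one_sub_pow_succ (R := R) hs).hasProd.tendsto_prod_nat.comp h2n
    have h2 : ∀ l : ℤ, Tendsto (fun n : ℕ => invQFactorial R s (n + l)) atTop (𝓝 u) := by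
      intro l
      have ht : Tendsto (fun n : ℕ => (n + l : ℤ).toNat) atTop atTop :=
        tendsto_atTop_mono (f := fun n : ℕ => n - l.natAbs) (fun n => by lia)
          (tendsto_sub_atTop_nat _)
      refine (hu.comp ht).congr' ?_
      filter_upwards [eventually_ge_atTop l.natAbs] with n hn
      rw [Function.comp_apply, Int.toNat_of_nonneg (by lia)]
    have h3 := h1.mul ((h2 (-k)).mul (h2 k))
    rw [show (∏' k : ℕ, (1 - (X ^ s : R⟦X⟧) ^ (k + 1))) * (u * u) = u by
      rw [← mul_assoc, mul_comm (∏' _, _) u, hu1, one_mul]] at h3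
    exact h3
  have hlim := (multipliable_one_add_mul_pow hs a).hasProd.tendsto_prod_nat.mul
    (multipliable_one_add_mul_pow hs b).hasProd.tendsto_prod_nat
  have hsum : HasSum (fun k => u * thetaMonomial a b k)
      ((∏' k : ℕ, (1 + a * (X ^ s) ^ k)) * (∏' k : ℕ, (1 + b * (X ^ s) ^ k))) := by
    rw [PowerSeries.WithPiTopology.hasSum_iff_hasSum_coeff]
    intro d
    -- In degree d only |k| ≤ d + 1 contributes, uniformly in n. Limit and sum can then be
    -- exchanged.
    have hz : ∀ (f : ℤ → R⟦X⟧) (k : ℤ), k ∉ Finset.Icc (-(d + 1 : ℤ)) (d + 1) →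
        coeff d (f k * thetaMonomial a b k) = 0 := by
      intro f k hk
      have hd := (X_pow_dvd_thetaMonomial hs hab (d + 1) (k := k) (by
        rw [Finset.mem_Icc, ← abs_le] at hk; push_cast; lia)).mul_left (f k)
      exact X_pow_dvd_iff.mp hd d (by lia)
    have hfin : ∀ n, coeff d (∏ k ∈ Finset.range n, ((1 + a * (X ^ s) ^ k) * (1 + b * (X ^ s) ^ k)))
        = ∑ k ∈ Finset.Icc (-(d + 1 : ℤ)) (d + 1),
          coeff d (finiteTripleCoeff R s n k * thetaMonomial a b k) := fun n =>
      ((PowerSeries.WithPiTopology.hasSum_iff_hasSum_coeff R).mp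
        (hasSum_finite_triple hs hab n) d).unique (hasSum_sum_of_ne_finset_zero fun k hk => hz _ k hk)
    have hright : Tendsto (fun n => ∑ k ∈ Finset.Icc (-(d + 1 : ℤ)) (d + 1),
        coeff d (finiteTripleCoeff R s n k * thetaMonomial a b k)) atTop
        (𝓝 (∑ k ∈ Finset.Icc (-(d + 1 : ℤ)) (d + 1), coeff d (u * thetaMonomial a b k))) :=
      tendsto_finsetSum _ fun k _ =>
        ((PowerSeries.WithPiTopology.continuous_coeff R d).tendsto _).comp
          ((hcoeff k).mul tendsto_const_nhds)
    have hleft := ((PowerSeries.WithPiTopology.continuous_coeff R d).tendsto _).comp hlim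
    have heq := tendsto_nhds_unique hleft (hright.congr fun n => by
      rw [← hfin n, Finset.prod_mul_distrib]; rfl)
    rw [heq]
    exact hasSum_sum_of_ne_finset_zero fun k hk => hz (fun _ => u) k hk
  have := hsum.mul_right (∏' k : ℕ, (1 - (X ^ s : R⟦X⟧) ^ (k + 1)))
  refine Eq.mpr (congrArg (fun f : ℤ → R⟦X⟧ => HasSum f _) (funext fun k => ?_)) this
  linear_combination -thetaMonomial a b k * hu1

end JacobiTriple

/-! ### Theta functions as lattice sums and as products -/

/-- The exponent of `X` in `(X^i)^{k(k+1)/2} (X^j)^{k(k-1)/2}`. -/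
def thetaExp (i j k : ℤ) : ℤ := i * (k * (k + 1) / 2) + j * (k * (k - 1) / 2)

/-- The theta function `f(s X^i, s X^j)` for a sign `s`. -/
def theta (s : ℤˣ) (i j : ℕ) : ℤ⟦X⟧ :=
  latticeSum (thetaExp i j) fun k => ((s ^ k : ℤˣ) : ℤ)

theorem two_mul_thetaExp (i j k : ℤ) :
    2 * thetaExp i j k = (i + j) * k ^ 2 + (i - j) * k := by
  have h1 := two_mul_tri k
  have h2 := two_mul_tri' k
  rw [thetaExp]
  linear_combination i * h1 + j * h2

theorem thetaExp_nonneg (i j : ℕ) (k : ℤ) : 0 ≤ thetaExp i j k := by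
  have := tri_nonneg k
  have := tri_nonneg' k
  rw [thetaExp]
  positivity

theorem locFin_theta {i j : ℕ} (h : 1 ≤ i + j) (c : ℤ → ℤ) : LocFin (thetaExp i j) c := by
  refine LocFin.of_bound 1 fun k _ => ?_
  have h1 := two_mul_tri k
  have h2 := two_mul_tri' k
  have h3 : |k| - 1 ≤ k * (k + 1) / 2 := by
    have e1 := two_mul_tri (k + 1)
    have e2 := tri_nonneg (k + 1)
    have e3 := tri_nonneg' k
    rcases abs_cases k with ⟨hk, _⟩ | ⟨hk, _⟩ <;> rw [hk] <;> linarith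
  have h4 : |k| - 1 ≤ k * (k - 1) / 2 := by
    have e1 := two_mul_tri' (k - 1)
    have e2 := tri_nonneg' (k - 1)
    have e3 := tri_nonneg k
    rcases abs_cases k with ⟨hk, _⟩ | ⟨hk, _⟩ <;> rw [hk] <;> linarith
  by_cases hk : k = 0
  · simp [hk, thetaExp]
  have h5 : 0 ≤ |k| - 1 := by have := abs_pos.mpr hk; lia
  have hij : (1 : ℤ) ≤ i + j := by exact_mod_cast h
  have := mul_le_mul_of_nonneg_left h3 (Int.natCast_nonneg i)
  have := mul_le_mul_of_nonneg_left h4 (Int.natCast_nonneg j)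
  rw [thetaExp]
  nlinarith

theorem units_zpow_eq (s : ℤˣ) (k l : ℤ) (h : ∃ m, k = l + 2 * m) : s ^ k = s ^ l := by
  obtain ⟨m, rfl⟩ := h
  rw [zpow_add, zpow_mul, show s ^ (2 : ℤ) = 1 from Int.units_sq s, one_zpow, mul_one]

theorem thetaMonomial_sign (s : ℤˣ) (i j : ℕ) (k : ℤ) :
    thetaMonomial (C (s : ℤ) * X ^ i) (C (s : ℤ) * X ^ j : ℤ⟦X⟧) k =
      C ((s ^ k : ℤˣ) : ℤ) * X ^ (thetaExp i j k).toNat := by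
  have h1 := tri_nonneg k
  have h2 := tri_nonneg' k
  have h3 := two_mul_tri k
  have h4 := two_mul_tri' k
  obtain ⟨x, hx⟩ := Int.eq_ofNat_of_zero_le h1
  obtain ⟨y, hy⟩ := Int.eq_ofNat_of_zero_le h2
  rw [thetaMonomial, thetaExp, hx, hy]
  have hs : s ^ k = s ^ (x + y) := by
    rw [← zpow_natCast]
    refine units_zpow_eq s _ _ ⟨-y, ?_⟩
    push_cast
    rw [hx] at h3
    rw [hy] at h4
    linarith
  rw [hs, show ((i : ℤ) * x + j * y).toNat = i * x + j * y by
    rw [← Nat.cast_mul, ← Nat.cast_mul, ← Nat.cast_add, Int.toNat_natCast]]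
  simp only [Int.toNat_natCast]
  push_cast
  rw [map_pow]
  ring

theorem theta_eq_prod (s : ℤˣ) {i j : ℕ} (h : 1 ≤ i + j) :
    theta s i j = qPoch (-(C (s : ℤ) * X ^ i)) (X ^ (i + j)) *
      qPoch (-(C (s : ℤ) * X ^ j)) (X ^ (i + j)) * eulerE (i + j) := by
  have hab : (C (s : ℤ) * X ^ i) * (C (s : ℤ) * X ^ j : ℤ⟦X⟧) = X ^ (i + j) := by
    have : (C (s : ℤ) * C (s : ℤ) : ℤ⟦X⟧) = 1 := by
      rw [← map_mul, ← Units.val_mul, Int.units_mul_self]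
      simp
    linear_combination X ^ i * X ^ j * this
  have := (jacobi_triple h hab).tsum_eq
  simp only [thetaMonomial_sign] at this
  rw [theta, latticeSum, this, qPoch, qPoch, eulerE, qPoch]
  congr 1
  · congr 1 <;> exact tprod_congr fun k => by ring
  · exact tprod_congr fun k => by ring

theorem theta_neg_eq_prod {i j : ℕ} (h : 1 ≤ i + j) :
    theta (-1) i j = qPoch (X ^ i) (X ^ (i + j)) * qPoch (X ^ j) (X ^ (i + j)) *
      eulerE (i + j) := by
  rw [theta_eq_prod _ h]
  simp

theorem theta_one_eq_prod {i j : ℕ} (h : 1 ≤ i + j) :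
    theta 1 i j = qPoch (-X ^ i) (X ^ (i + j)) * qPoch (-X ^ j) (X ^ (i + j)) *
      eulerE (i + j) := by
  rw [theta_eq_prod _ h]
  simp

theorem ramanujanTheta_X_pow (i j : ℕ) : ramanujanTheta (X ^ i) (X ^ j) = theta 1 i j := by
  rw [ramanujanTheta, theta, latticeSum]
  refine tsum_congr fun k => ?_
  have := thetaMonomial_sign 1 i j k
  simp only [Units.val_one, map_one, one_mul] at this
  rw [← this, thetaMonomial]

theorem multipliable_qPoch (a : ℤ⟦X⟧) {s : ℕ} (hs : 1 ≤ s) :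
    Multipliable fun k : ℕ => 1 - a * (X ^ s) ^ k :=
  (multipliable_one_add_mul_pow hs (-a)).congr fun k => by ring

/-- Splitting an infinite product by residue classes. -/
theorem qPoch_split (a : ℤ⟦X⟧) {s m : ℕ} (hs : 1 ≤ s) (hm : 1 ≤ m) :
    qPoch a (X ^ s) = ∏ r ∈ Finset.range m, qPoch (a * X ^ (s * r)) (X ^ (s * m)) := by
  have : NeZero m := ⟨by lia⟩
  let e : Fin m × ℕ ≃ ℕ := (Equiv.prodComm _ _).trans (Nat.divModEquiv m).symm
  have he : ∀ r k, e (r, k) = m * k + r := fun r k => by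
    simp [e, Nat.divModEquiv]; ring
  have hf := multipliable_qPoch a hs
  have hmul : Multipliable fun x : Fin m × ℕ => 1 - a * (X ^ s) ^ (e x) :=
    e.multipliable_iff.mpr hf
  have hterm : ∀ (r : Fin m) (k : ℕ), 1 - a * (X ^ s) ^ (e (r, k)) =
      1 - a * X ^ (s * r) * (X ^ (s * m)) ^ k := fun r k => by
    rw [he]
    ring
  have hfib : ∀ r : Fin m, Multipliable fun k : ℕ => 1 - a * (X ^ s) ^ (e (r, k)) := fun r =>
    (multipliable_qPoch (a * X ^ (s * r)) (s := s * m) (by nlinarith)).congr fun k => (hterm r k).symm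
  rw [qPoch, ← e.tprod_eq, hmul.tprod_prod' hfib, tprod_fintype, ← Fin.prod_univ_eq_prod_range
    (fun r => qPoch (a * X ^ (s * r)) (X ^ (s * m)))]
  exact Finset.prod_congr rfl fun r _ => tprod_congr fun k => hterm r k

theorem qPoch_neg_mul (a : ℤ⟦X⟧) {s : ℕ} (hs : 1 ≤ s) :
    qPoch (-a) (X ^ s) * qPoch a (X ^ s) = qPoch (a ^ 2) (X ^ (2 * s)) := by
  rw [qPoch, qPoch, qPoch, ← (multipliable_qPoch _ hs).tprod_mul (multipliable_qPoch _ hs)]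
  exact tprod_congr fun k => by ring

theorem qPoch_eq_mul (a : ℤ⟦X⟧) {s : ℕ} (hs : 1 ≤ s) :
    qPoch a (X ^ s) = (1 - a) * qPoch (a * X ^ s) (X ^ s) := by
  have h := multipliable_qPoch (a * X ^ s) hs
  rw [qPoch, qPoch, tprod_eq_zero_mul' (h.congr fun k => by ring)]
  congr 1
  · simp
  · exact tprod_congr fun k => by ring

/-- `(q^i; q^10)_∞ (q^{10-i}; q^10)_∞`. -/
def tenPair (i : ℕ) : ℤ⟦X⟧ := qPoch (X ^ i) (X ^ 10) * qPoch (X ^ (10 - i)) (X ^ 10)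

theorem eulerE_five : eulerE 5 = qPoch (X ^ 5) (X ^ 10) * eulerE 10 := by
  rw [eulerE, qPoch_split _ (m := 2) (by norm_num) (by norm_num)]
  simp only [Finset.prod_range_succ, Finset.prod_range_zero, one_mul, ← pow_add, eulerE]

theorem eulerE_two : eulerE 2 = tenPair 2 * tenPair 4 * eulerE 10 := by
  rw [eulerE, qPoch_split _ (m := 5) (by norm_num) (by norm_num)]
  simp only [Finset.prod_range_succ, Finset.prod_range_zero, one_mul, ← pow_add,
    eulerE, tenPair, Nat.reduceSub]
  ring

theorem eulerE_one : eulerE 1 = tenPair 1 * tenPair 2 * tenPair 3 * tenPair 4 *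
    qPoch (X ^ 5) (X ^ 10) * eulerE 10 := by
  rw [eulerE, qPoch_split _ (m := 10) (by norm_num) (by norm_num)]
  simp only [Finset.prod_range_succ, Finset.prod_range_zero, one_mul, ← pow_add,
    Nat.reduceAdd, eulerE, tenPair, Nat.reduceSub]
  ring

theorem theta_neg_ten {i : ℕ} (hi : i ≤ 10) :
    theta (-1) i (10 - i) = tenPair i * eulerE 10 := by
  rw [theta_neg_eq_prod (by lia), show i + (10 - i) = 10 by lia, tenPair]

theorem qPoch_five (i : ℕ) :
    qPoch (X ^ i) (X ^ 5) = qPoch (X ^ i) (X ^ 10) * qPoch (X ^ (i + 5)) (X ^ 10) := by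
  rw [qPoch_split _ (m := 2) (by norm_num) (by norm_num)]
  simp only [Finset.prod_range_succ, Finset.prod_range_zero, one_mul, ← pow_add, Nat.reduceMul,
    add_zero]

theorem theta_neg_one_four :
    theta (-1) 1 4 = tenPair 1 * tenPair 4 * (qPoch (X ^ 5) (X ^ 10) * eulerE 10) := by
  rw [theta_neg_eq_prod (by lia)]
  simp only [Nat.reduceAdd]
  rw [eulerE_five, qPoch_five, qPoch_five, tenPair,
    tenPair]
  ring

theorem theta_neg_two_three :
    theta (-1) 2 3 = tenPair 2 * tenPair 3 * (qPoch (X ^ 5) (X ^ 10) * eulerE 10) := by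
  rw [theta_neg_eq_prod (by lia)]
  simp only [Nat.reduceAdd]
  rw [eulerE_five, qPoch_five, qPoch_five, tenPair,
    tenPair]
  ring

/-- The factors (-x; q^5)_∞ are removed with (-x; q^5)_∞ (x; q^5)_∞ = (x²; q^10)_∞. -/
theorem theta_one_four :
    theta 1 1 4 * (tenPair 1 * tenPair 4) =
      tenPair 2 * (qPoch (X ^ 5) (X ^ 10) * eulerE 10) := by
  have h1 := qPoch_neg_mul (X ^ 1) (s := 5) (by norm_num)
  have h2 := qPoch_neg_mul (X ^ 4) (s := 5) (by norm_num)
  rw [qPoch_five] at h1 h2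
  simp only [← pow_mul, Nat.reduceMul, Nat.reduceAdd] at h1 h2
  rw [theta_one_eq_prod (by lia)]
  simp only [Nat.reduceAdd]
  rw [eulerE_five, tenPair, tenPair,
    tenPair]
  simp only [Nat.reduceSub]
  rw [← h1, ← h2]
  ring

theorem theta_two_three :
    theta 1 2 3 * (tenPair 2 * tenPair 3) =
      tenPair 4 * (qPoch (X ^ 5) (X ^ 10) * eulerE 10) := by
  have h1 := qPoch_neg_mul (X ^ 2) (s := 5) (by norm_num)
  have h2 := qPoch_neg_mul (X ^ 3) (s := 5) (by norm_num)
  rw [qPoch_five] at h1 h2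
  simp only [← pow_mul, Nat.reduceMul, Nat.reduceAdd] at h1 h2
  rw [theta_one_eq_prod (by lia)]
  simp only [Nat.reduceAdd]
  rw [eulerE_five, tenPair, tenPair,
    tenPair]
  simp only [Nat.reduceSub]
  rw [← h1, ← h2]
  ring

theorem qPoch_mul_eulerE {r : ℕ} (hr : 1 ≤ r) :
    qPoch (X ^ r) (X ^ (r + r)) * eulerE (r + r) = eulerE r := by
  rw [eulerE, eulerE, qPoch_split (X ^ r) (s := r) (m := 2) hr (by norm_num)]
  simp only [Finset.prod_range_succ, Finset.prod_range_zero, one_mul, ← pow_add, mul_zero,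
    add_zero, mul_one, mul_two]

theorem theta_neg_self {r : ℕ} (hr : 1 ≤ r) :
    theta (-1) r r * eulerE (r + r) = eulerE r ^ 2 := by
  rw [theta_neg_eq_prod (by lia), ← qPoch_mul_eulerE hr]
  ring

/-- Euler's pentagonal number theorem: the three products run over the residue classes modulo 3. -/
theorem theta_neg_pentagonal {r : ℕ} (hr : 1 ≤ r) : theta (-1) r (2 * r) = eulerE r := by
  rw [theta_neg_eq_prod (by lia), eulerE, eulerE,
    qPoch_split (X ^ r) (s := r) (m := 3) hr (by norm_num)]
  simp only [Finset.prod_range_succ, Finset.prod_range_zero, one_mul, ← pow_add]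
  congr 3 <;> ring

/-- `theta 1 0 r` is 2ψ(q^r). The 2 is the first factor 1 - (-1) of (-1; q^r)_∞. -/
theorem theta_zero_mul_eulerE {r : ℕ} (hr : 1 ≤ r) :
    theta 1 0 r * eulerE r = 2 * eulerE (2 * r) ^ 2 := by
  have h := qPoch_neg_mul (X ^ r) hr
  rw [← pow_mul, mul_comm r 2] at h
  rw [theta_one_eq_prod (by lia), zero_add, pow_zero, qPoch_eq_mul (-1) hr, neg_one_mul]
  simp only [eulerE]
  rw [← h]
  ring

/-! ### Identities between products of two theta functions -/

theorem latticeSum_partition {ι κ : Type*} {m : ℕ} {w c : ι → ℤ} (h : LocFin w c)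
    (g : Fin m → κ → ι) (hg : Function.Bijective fun x : Fin m × κ => g x.1 x.2) :
    latticeSum w c = ∑ r, latticeSum (fun k => w (g r k)) (fun k => c (g r k)) := by
  have hinj : ∀ r, Function.Injective (g r) := fun r k k' hk =>
    (Prod.ext_iff.mp (hg.1 (a₁ := (r, k)) (a₂ := (r, k')) hk)).2
  rw [← latticeSum_equiv (Equiv.ofBijective _ hg), latticeSum,
    (h.comp_injective (Equiv.ofBijective _ hg).injective).summable.tsum_prod'
      fun r => (h.comp_injective (hinj r)).summable, tsum_fintype]
  rfl

theorem theta_mul_theta (s t : ℤˣ) {i j i' j' : ℕ} (h : 1 ≤ i + j) (h' : 1 ≤ i' + j') :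
    theta s i j * theta t i' j' =
      latticeSum (fun x : ℤ × ℤ => thetaExp i j x.1 + thetaExp i' j' x.2)
        (fun x => ((s ^ x.1 * t ^ x.2 : ℤˣ) : ℤ)) := by
  rw [theta, theta, latticeSum_mul (locFin_theta h _) (locFin_theta h' _)
    (fun _ _ => thetaExp_nonneg _ _ _) fun _ _ => thetaExp_nonneg _ _ _]
  simp only [Units.val_mul]

theorem locFin_theta_mul_theta {i j i' j' : ℕ} (h : 1 ≤ i + j) (h' : 1 ≤ i' + j')
    (c : ℤ × ℤ → ℤ) :
    LocFin (fun x : ℤ × ℤ => thetaExp i j x.1 + thetaExp i' j' x.2) c :=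
  ((locFin_theta h fun _ => 1).prod (locFin_theta h' fun _ => 1)
    (fun _ _ => thetaExp_nonneg _ _ _) fun _ _ => thetaExp_nonneg _ _ _).of_support
      fun _ _ => by norm_num

theorem X_pow_mul_theta_mul_theta (n : ℕ) (s t : ℤˣ) {i j i' j' : ℕ} (h : 1 ≤ i + j)
    (h' : 1 ≤ i' + j') :
    X ^ n * (theta s i j * theta t i' j') =
      latticeSum (fun x : ℤ × ℤ => thetaExp i j x.1 + thetaExp i' j' x.2 + n)
        (fun x => ((s ^ x.1 * t ^ x.2 : ℤˣ) : ℤ)) := by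
  rw [theta_mul_theta s t h h', X_pow_mul_latticeSum _ (locFin_theta_mul_theta h h' _)]
  exact fun x _ => add_nonneg (thetaExp_nonneg _ _ _) (thetaExp_nonneg _ _ _)

theorem neg_one_zpow_congr {k l : ℤ} (h : (k - l) % 2 = 0) : (-1 : ℤˣ) ^ k = (-1) ^ l :=
  units_zpow_eq _ _ _ ⟨(k - l) / 2, by lia⟩

theorem neg_one_zpow_eq_neg {k l : ℤ} (h : (k - l) % 2 = 1) : (-1 : ℤˣ) ^ k = -(-1) ^ l := by
  rw [units_zpow_eq (-1) k (l + 1) ⟨(k - l - 1) / 2, by lia⟩, zpow_add, zpow_one, mul_neg_one]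

theorem eq_of_two_mul_eq {m n : ℤ} (h : 2 * m = 2 * n) : m = n := by lia

theorem bijective_parity :
    Function.Bijective fun x : Fin 2 × (ℤ × ℤ) =>
      (![fun y => (y.1 + y.2, y.1 - y.2), fun y => (1 - y.1 - y.2, y.2 - y.1)] :
        Fin 2 → ℤ × ℤ → ℤ × ℤ) x.1 x.2 := by
  constructor
  · rintro ⟨r, u, v⟩ ⟨r', u', v'⟩ h
    fin_cases r <;> fin_cases r' <;> simp [Prod.ext_iff] at h ⊢ <;> lia
  · rintro ⟨m, n⟩
    rcases Int.even_or_odd' (m + n) with ⟨u, h | h⟩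
    · exact ⟨(0, u, m - u), by simp [Prod.ext_iff]; lia⟩
    · exact ⟨(1, -u, u + 1 - m), by simp [Prod.ext_iff]; lia⟩

/-- The parity splitting `∑ F(m, n) = ∑ F(u + v, u - v) + ∑ F(1 - u - v, v - u)`. -/
theorem latticeSum_parity {w c : ℤ × ℤ → ℤ} (h : LocFin w c) :
    latticeSum w c =
      latticeSum (fun x : ℤ × ℤ => w (x.1 + x.2, x.1 - x.2)) (fun x => c (x.1 + x.2, x.1 - x.2)) +
      latticeSum (fun x : ℤ × ℤ => w (1 - x.1 - x.2, x.2 - x.1))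
        (fun x => c (1 - x.1 - x.2, x.2 - x.1)) := by
  rw [latticeSum_partition h _ bijective_parity, Fin.sum_univ_two]
  rfl

/-- Both exponents have leading coefficient 5/2, so the substitution m, n = u ± v on each parity
class of m + n removes the cross terms and separates the variables. -/
theorem theta_one_four_mul_theta_neg_two_three :
    theta 1 1 4 * theta (-1) 2 3 =
      theta (-1) 3 7 * theta (-1) 4 6 + X ^ 1 * (theta (-1) 2 8 * theta (-1) 1 9) := by
  rw [theta_mul_theta _ _ (by lia) (by lia), theta_mul_theta _ _ (by lia) (by lia),
    X_pow_mul_theta_mul_theta _ _ _ (by lia) (by lia),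
    latticeSum_parity (locFin_theta_mul_theta (by lia) (by lia) _)]
  congr 1 <;> refine latticeSum_congr (fun x => ?_) (fun x _ => eq_of_two_mul_eq ?_)
  · rw [one_zpow, one_mul, ← zpow_add]
    exact congrArg Units.val (neg_one_zpow_congr (by lia))
  · simp only [mul_add, two_mul_thetaExp]; push_cast; ring
  · rw [one_zpow, one_mul, ← zpow_add]
    exact congrArg Units.val (neg_one_zpow_congr (by lia))
  · simp only [mul_add, two_mul_thetaExp]; push_cast; ring

/-- The same splitting with sign (-1)^m in place of (-1)^n. The two signs differ exactly on the
class where m + n is odd. -/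
theorem theta_neg_one_four_mul_theta_two_three :
    theta (-1) 1 4 * theta 1 2 3 =
      theta (-1) 3 7 * theta (-1) 4 6 - X ^ 1 * (theta (-1) 2 8 * theta (-1) 1 9) := by
  rw [theta_mul_theta _ _ (by lia) (by lia), theta_mul_theta _ _ (by lia) (by lia),
    X_pow_mul_theta_mul_theta _ _ _ (by lia) (by lia), sub_eq_add_neg, ← latticeSum_neg,
    latticeSum_parity (locFin_theta_mul_theta (by lia) (by lia) _)]
  congr 1 <;> refine latticeSum_congr (fun x => ?_) (fun x _ => eq_of_two_mul_eq ?_)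
  · rw [one_zpow, mul_one, ← zpow_add]
  · simp only [mul_add, two_mul_thetaExp]; push_cast; ring
  · rw [one_zpow, mul_one, ← zpow_add, ← Units.val_neg]
    exact congrArg Units.val (neg_one_zpow_eq_neg (by lia))
  · simp only [mul_add, two_mul_thetaExp]; push_cast; ring

/-- The class with m + n odd cancels under v ↦ 1 - v. What remains is an even series, which is why
f(q, q^9) is the right multiplier. -/
theorem theta_neg_mul_theta_one_nine :
    theta (-1) 1 9 * theta 1 1 9 = theta (-1) 2 18 * theta (-1) 10 10 := by
  rw [theta_mul_theta _ _ (by lia) (by lia), theta_mul_theta _ _ (by lia) (by lia),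
    latticeSum_parity (locFin_theta_mul_theta (by lia) (by lia) _)]
  conv_rhs => rw [← add_zero (latticeSum _ _)]
  congr 1
  · refine latticeSum_congr (fun x => ?_) (fun x _ => eq_of_two_mul_eq ?_)
    · rw [one_zpow, mul_one, ← zpow_add]
    · simp only [mul_add, two_mul_thetaExp]; push_cast; ring
  · refine latticeSum_eq_zero ((Equiv.refl ℤ).prodCongr (Equiv.subLeft (1 : ℤ)))
      (fun x _ => eq_of_two_mul_eq ?_) fun x => ?_
    · simp only [mul_add, two_mul_thetaExp, Equiv.prodCongr_apply, Prod.map, Equiv.refl_apply,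
        Equiv.subLeft_apply]
      push_cast; ring
    · simp only [Equiv.prodCongr_apply, Prod.map, Equiv.refl_apply, Equiv.subLeft_apply]
      rw [one_zpow, one_zpow, mul_one, mul_one, ← Units.val_neg]
      exact congrArg Units.val (neg_one_zpow_eq_neg (by lia))

/-- `φ(-q^r)^2 = φ(q^{2r})^2 - 4 q^r ψ(q^{4r})^2`. -/
theorem theta_neg_self_sq {r : ℕ} (hr : 1 ≤ r) :
    theta (-1) r r * theta (-1) r r =
      theta 1 (2 * r) (2 * r) * theta 1 (2 * r) (2 * r) -
        X ^ r * (theta 1 0 (4 * r) * theta 1 0 (4 * r)) := by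
  rw [theta_mul_theta _ _ (by lia) (by lia), theta_mul_theta _ _ (by lia) (by lia),
    X_pow_mul_theta_mul_theta _ _ _ (by lia) (by lia), sub_eq_add_neg, ← latticeSum_neg,
    latticeSum_parity (locFin_theta_mul_theta (by lia) (by lia) _)]
  congr 1 <;> refine latticeSum_congr (fun x => ?_) (fun x _ => eq_of_two_mul_eq ?_)
  · rw [one_zpow, one_zpow, mul_one, ← zpow_add, neg_one_zpow_congr (l := 0) (by lia), zpow_zero]
  · simp only [mul_add, two_mul_thetaExp]; push_cast; ring
  · rw [one_zpow, one_zpow, mul_one, ← zpow_add, ← Units.val_neg, neg_one_zpow_eq_neg (l := 0) (by lia),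
      zpow_zero]
  · simp only [mul_add, two_mul_thetaExp]; push_cast; ring

/-- Multiplication by `2 + i` on `ℤ[i]`, and the four translates by a unit. -/
def gaussianMap : Fin 5 → ℤ × ℤ → ℤ × ℤ :=
  ![fun y => (2 * y.1 - y.2, y.1 + 2 * y.2), fun y => (1 - 2 * y.1 - y.2, 2 * y.2 - y.1),
    fun y => (y.1 - 2 * y.2, 1 - 2 * y.1 - y.2), fun y => (2 * y.1 + y.2 - 1, y.1 - 2 * y.2),
    fun y => (2 * y.2 - y.1, 2 * y.1 + y.2 - 1)]

theorem bijective_gaussian :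
    Function.Bijective fun x : Fin 5 × (ℤ × ℤ) =>
      gaussianMap x.1 x.2 := by
  constructor
  · rintro ⟨r, u, v⟩ ⟨r', u', v'⟩ h
    fin_cases r <;> fin_cases r' <;> simp [gaussianMap, Prod.ext_iff] at h ⊢ <;> lia
  · rintro ⟨m, n⟩
    have : (m - 2 * n) % 5 = 0 ∨ (m - 2 * n) % 5 = 1 ∨ (m - 2 * n) % 5 = 3 ∨
      (m - 2 * n) % 5 = 4 ∨ (m - 2 * n) % 5 = 2 := by lia
    rcases this with h | h | h | h | h
    · exact ⟨(0, (2 * m + n) / 5, (2 * n - m) / 5), by simp [gaussianMap, Prod.ext_iff]; lia⟩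
    · exact ⟨(1, (2 - 2 * m - n) / 5, (1 - m + 2 * n) / 5), by simp [gaussianMap, Prod.ext_iff]; lia⟩
    · exact ⟨(2, (2 - 2 * n + m) / 5, (1 - n - 2 * m) / 5), by simp [gaussianMap, Prod.ext_iff]; lia⟩
    · exact ⟨(3, (2 + 2 * m + n) / 5, (1 + m - 2 * n) / 5), by simp [gaussianMap, Prod.ext_iff]; lia⟩
    · exact ⟨(4, (2 + 2 * n - m) / 5, (1 + n + 2 * m) / 5), by simp [gaussianMap, Prod.ext_iff]; lia⟩

/-- The left side is ∑ (-1)^{m+n} q^{m²+n²} over ℤ[i]. Multiples of 2 + i have norms multiplied by 5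
and give φ(-q^5)²; the other four cosets are permuted by the units, hence contribute equally. -/
theorem theta_neg_one_one_sq :
    theta (-1) 1 1 * theta (-1) 1 1 = theta (-1) 5 5 * theta (-1) 5 5 -
      4 * (X ^ 1 * (theta (-1) 1 9 * theta (-1) 3 7)) := by
  have key : ∀ r : Fin 4, latticeSum
      (fun k => (fun x : ℤ × ℤ => thetaExp (1 : ℕ) (1 : ℕ) x.1 + thetaExp (1 : ℕ) (1 : ℕ) x.2) (gaussianMap r.succ k))
      (fun k => (fun x : ℤ × ℤ => (((-1) ^ x.1 * (-1) ^ x.2 : ℤˣ) : ℤ)) (gaussianMap r.succ k))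
      = -(X ^ 1 * (theta (-1) 1 9 * theta (-1) 3 7)) := by
    intro r
    rw [X_pow_mul_theta_mul_theta _ _ _ (by lia) (by lia), ← latticeSum_neg]
    refine latticeSum_congr (fun x => ?_) (fun x _ => eq_of_two_mul_eq ?_)
    · beta_reduce
      rw [← zpow_add, ← zpow_add, ← Units.val_neg, ← neg_one_zpow_eq_neg]
      fin_cases r <;> simp [gaussianMap] <;> lia
    · fin_cases r <;> simp [gaussianMap, mul_add, two_mul_thetaExp] <;> ring
  rw [theta_mul_theta _ _ (by lia) (by lia), theta_mul_theta _ _ (by lia) (by lia),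
    latticeSum_partition (locFin_theta_mul_theta (by lia) (by lia) _) _ bijective_gaussian,
    Fin.sum_univ_succ]
  rw [Finset.sum_congr rfl fun r _ => key r, Finset.sum_const, sub_eq_add_neg]
  congr 1
  · refine latticeSum_congr (fun x => ?_) (fun x _ => eq_of_two_mul_eq ?_)
    · rw [← zpow_add, ← zpow_add, neg_one_zpow_congr]
      simp [gaussianMap]; lia
    · simp [gaussianMap, mul_add, two_mul_thetaExp]; ring
  · simp

/-- Multiplication by `2 + i` on the points `(2m - 1) + (2n - 1)i`, and the four translates by a
unit. -/
def gaussianOddMap : Fin 5 → ℤ × ℤ → ℤ × ℤ :=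
  ![fun y => (2 * y.1 - y.2, y.1 + 2 * y.2 - 1),
    fun y => (1 - 2 * y.1 + y.2, 1 - y.1 - 2 * y.2),
    fun y => (y.1 + 2 * y.2, 1 - 2 * y.1 + y.2),
    fun y => (2 * y.1 - y.2, y.1 + 2 * y.2),
    fun y => (1 - y.1 - 2 * y.2, 2 * y.1 - y.2)]

theorem bijective_gaussianOdd :
    Function.Bijective fun x : Fin 5 × (ℤ × ℤ) => gaussianOddMap x.1 x.2 := by
  constructor
  · rintro ⟨r, u, v⟩ ⟨r', u', v'⟩ h
    fin_cases r <;> fin_cases r' <;> simp [gaussianOddMap, Prod.ext_iff] at h ⊢ <;> lia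
  · rintro ⟨m, n⟩
    have : (m - 2 * n) % 5 = 2 ∨ (m - 2 * n) % 5 = 4 ∨ (m - 2 * n) % 5 = 3 ∨
      (m - 2 * n) % 5 = 0 ∨ (m - 2 * n) % 5 = 1 := by lia
    rcases this with h | h | h | h | h
    · exact ⟨(0, (2 * m + n + 1) / 5, (2 * n - m + 2) / 5), by
        simp [gaussianOddMap, Prod.ext_iff]; lia⟩
    · exact ⟨(1, (3 - 2 * m - n) / 5, (1 + m - 2 * n) / 5), by
        simp [gaussianOddMap, Prod.ext_iff]; lia⟩
    · exact ⟨(2, (2 + m - 2 * n) / 5, (2 * m + n - 1) / 5), by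
        simp [gaussianOddMap, Prod.ext_iff]; lia⟩
    · exact ⟨(3, (2 * m + n) / 5, (2 * n - m) / 5), by
        simp [gaussianOddMap, Prod.ext_iff]; lia⟩
    · exact ⟨(4, (1 - m + 2 * n) / 5, (2 - 2 * m - n) / 5), by
        simp [gaussianOddMap, Prod.ext_iff]; lia⟩

/-- The same splitting on points with odd coordinates 2m - 1, 2n - 1, whose norm is 8 times the
exponent plus 2. In terms of ψ it reads ψ(q)² - qψ(q^5)² = f(q, q^4) f(q^2, q^3). -/
theorem theta_zero_one_sq :
    theta 1 0 1 * theta 1 0 1 = X ^ 1 * (theta 1 0 5 * theta 1 0 5) +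
      4 * (theta 1 1 4 * theta 1 2 3) := by
  have key : ∀ r : Fin 4, latticeSum
      (fun k => (fun x : ℤ × ℤ => thetaExp (0 : ℕ) (1 : ℕ) x.1 + thetaExp (0 : ℕ) (1 : ℕ) x.2)
        (gaussianOddMap r.succ k))
      (fun k => (fun x : ℤ × ℤ => ((1 ^ x.1 * 1 ^ x.2 : ℤˣ) : ℤ)) (gaussianOddMap r.succ k))
      = theta 1 1 4 * theta 1 2 3 := by
    intro r
    rw [theta_mul_theta _ _ (by lia) (by lia)]
    refine latticeSum_congr (fun x => ?_) (fun x _ => eq_of_two_mul_eq ?_)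
    · simp only [one_zpow]
    · fin_cases r <;> simp [gaussianOddMap, mul_add, two_mul_thetaExp] <;> ring
  rw [theta_mul_theta _ _ (by lia) (by lia), X_pow_mul_theta_mul_theta _ _ _ (by lia) (by lia),
    latticeSum_partition (locFin_theta_mul_theta (by lia) (by lia) _) _ bijective_gaussianOdd,
    Fin.sum_univ_succ]
  rw [Finset.sum_congr rfl fun r _ => key r, Finset.sum_const]
  congr 1
  · refine latticeSum_congr (fun x => ?_) (fun x _ => eq_of_two_mul_eq ?_)
    · simp only [one_zpow]
    · simp [gaussianOddMap, mul_add, two_mul_thetaExp]; ring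
  · simp

theorem abs_le_sq (y : ℤ) : |y| ≤ y ^ 2 := by
  rw [← sq_abs]
  nlinarith [Int.one_le_abs (z := y), abs_nonneg y, em (y = 0), sq_nonneg (|y| - 1)]

/-- `((y + 2e + 1)^2 + 5y^2 - 1) / 2`. -/
def normFiveExp (x : ℤ × ℤ) : ℤ :=
  3 * x.1 ^ 2 + x.1 * (2 * x.2 + 1) + 2 * x.2 ^ 2 + 2 * x.2

theorem locFin_norm_five (c : ℤ × ℤ → ℤ) : LocFin normFiveExp c := by
  refine LocFin.of_bound₂ 2 fun y e _ => ?_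
  have h1 : |y| ≤ y ^ 2 := abs_le_sq y
  have h2 : |y + 2 * e + 1| ≤ (y + 2 * e + 1) ^ 2 := abs_le_sq _
  have h3 := abs_nonneg y
  simp only [normFiveExp]
  constructor
  · nlinarith [abs_nonneg (y + 2 * e + 1)]
  · have h4 : 2 * |e| ≤ |y + 2 * e + 1| + |y| + 1 := by
      have := abs_cases e
      have := abs_cases y
      have := abs_cases (y + 2 * e + 1)
      lia
    nlinarith

/-- Splitting by the residue modulo 3. -/
def modThreeMap : Fin 3 → ℤ × ℤ → ℤ × ℤ :=
  ![fun y => (y.2 - y.1, -3 * y.2), fun y => (y.1, 3 * y.2 + 1),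
    fun y => (y.1 - y.2, 3 * y.2 - 1)]

theorem bijective_mod_three :
    Function.Bijective fun x : Fin 3 × (ℤ × ℤ) =>
      modThreeMap x.1 x.2 := by
  constructor
  · rintro ⟨r, u, v⟩ ⟨r', u', v'⟩ h
    fin_cases r <;> fin_cases r' <;> simp [modThreeMap, Prod.ext_iff] at h ⊢ <;> lia
  · rintro ⟨m, n⟩
    have : n % 3 = 0 ∨ n % 3 = 1 ∨ n % 3 = 2 := by lia
    rcases this with h | h | h
    · exact ⟨(0, -(n / 3) - m, -(n / 3)), by simp [modThreeMap, Prod.ext_iff]; lia⟩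
    · exact ⟨(1, m, n / 3), by simp [modThreeMap, Prod.ext_iff]; lia⟩
    · exact ⟨(2, m + (n + 1) / 3, (n + 1) / 3), by simp [modThreeMap, Prod.ext_iff]; lia⟩

/-- Splitting by the residue modulo 2. -/
def modTwoMap : Fin 2 → ℤ × ℤ → ℤ × ℤ :=
  ![fun y => (2 * y.2, y.1 - y.2 - 1), fun y => (2 * y.2 - 1, y.1 - y.2)]

theorem bijective_mod_two :
    Function.Bijective fun x : Fin 2 × (ℤ × ℤ) =>
      modTwoMap x.1 x.2 := by
  constructor
  · rintro ⟨r, u, v⟩ ⟨r', u', v'⟩ h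
    fin_cases r <;> fin_cases r' <;> simp [modTwoMap, Prod.ext_iff] at h ⊢ <;> lia
  · rintro ⟨m, n⟩
    rcases Int.even_or_odd' m with ⟨u, h | h⟩
    · exact ⟨(0, n + u + 1, u), by simp [modTwoMap, Prod.ext_iff]; lia⟩
    · exact ⟨(1, n + u + 1, u + 1), by simp [modTwoMap, Prod.ext_iff]; lia⟩

/-- `ψ(q^4)φ(q^10) - q^2 φ(q^2)ψ(q^20) = E_2 E_10`. -/
theorem theta_level_twenty :
    theta 1 0 4 * theta 1 10 10 - X ^ 2 * (theta 1 2 2 * theta 1 0 20) =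
      2 * (theta (-1) 2 4 * theta (-1) 10 20) := by
  -- The single series ∑ (-1)^y q^{normFiveExp(y, e)} is evaluated twice. Splitting by the parity of
  -- y gives the left side; splitting by e modulo 3 gives two equal products and one class that
  -- cancels.
  have hF := locFin_norm_five fun x => (((-1) ^ x.1 : ℤˣ) : ℤ)
  have e0 : latticeSum (fun x => normFiveExp (modTwoMap 0 x))
      (fun x => (((-1) ^ (modTwoMap 0 x).1 : ℤˣ) : ℤ)) = theta 1 0 4 * theta 1 10 10 := by
    rw [theta_mul_theta _ _ (by lia) (by lia)]
    refine latticeSum_congr (fun x => ?_) (fun x _ => eq_of_two_mul_eq ?_)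
    · rw [one_zpow, one_zpow, mul_one, neg_one_zpow_congr (l := 0), zpow_zero]
      simp [modTwoMap]
    · simp [mul_add, two_mul_thetaExp, normFiveExp, modTwoMap]; ring
  have e1 : latticeSum (fun x => normFiveExp (modTwoMap 1 x))
      (fun x => (((-1) ^ (modTwoMap 1 x).1 : ℤˣ) : ℤ)) =
        -(X ^ 2 * (theta 1 2 2 * theta 1 0 20)) := by
    rw [X_pow_mul_theta_mul_theta _ _ _ (by lia) (by lia), ← latticeSum_neg]
    refine latticeSum_congr (fun x => ?_) (fun x _ => eq_of_two_mul_eq ?_)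
    · rw [one_zpow, one_zpow, mul_one, neg_one_zpow_eq_neg (l := 0), zpow_zero]
      · rfl
      · simp [modTwoMap]
    · simp [mul_add, two_mul_thetaExp, normFiveExp, modTwoMap]; ring
  have f0 : latticeSum (fun x => normFiveExp (modThreeMap 0 x))
      (fun x => (((-1) ^ (modThreeMap 0 x).1 : ℤˣ) : ℤ)) =
        theta (-1) 2 4 * theta (-1) 10 20 := by
    rw [theta_mul_theta _ _ (by lia) (by lia)]
    refine latticeSum_congr (fun x => ?_) (fun x _ => eq_of_two_mul_eq ?_)
    · rw [← zpow_add]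
      exact congrArg Units.val (neg_one_zpow_congr (by simp [modThreeMap]; lia))
    · simp [mul_add, two_mul_thetaExp, normFiveExp, modThreeMap]; ring
  have f1 : latticeSum (fun x => normFiveExp (modThreeMap 1 x))
      (fun x => (((-1) ^ (modThreeMap 1 x).1 : ℤˣ) : ℤ)) = 0 := by
    refine latticeSum_eq_zero
      ⟨fun x => (-x.1 - (2 * x.2 + 1), x.2), fun x => (-x.1 - (2 * x.2 + 1), x.2),
        fun x => by simp, fun x => by simp⟩ (fun x _ => ?_) fun x => ?_
    · simp [normFiveExp, modThreeMap]; ring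
    · rw [← Units.val_neg]
      exact congrArg Units.val (neg_one_zpow_eq_neg (by simp [modThreeMap]; lia))
  have f2 : latticeSum (fun x => normFiveExp (modThreeMap 2 x))
      (fun x => (((-1) ^ (modThreeMap 2 x).1 : ℤˣ) : ℤ)) =
        theta (-1) 2 4 * theta (-1) 10 20 := by
    rw [theta_mul_theta _ _ (by lia) (by lia)]
    refine latticeSum_congr (fun x => ?_) (fun x _ => eq_of_two_mul_eq ?_)
    · rw [← zpow_add]
      exact congrArg Units.val (neg_one_zpow_congr (by simp [modThreeMap]; lia))
    · simp [mul_add, two_mul_thetaExp, normFiveExp, modThreeMap]; ring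
  have h2 := latticeSum_partition hF _ bijective_mod_two
  have h3 := latticeSum_partition hF _ bijective_mod_three
  rw [h3, Fin.sum_univ_three, Fin.sum_univ_two, e0, e1, f0, f1, f2] at h2
  rw [sub_eq_add_neg, ← h2]
  ring

/-! ### Jacobi's identity for the cube of the Euler product -/

instance instDiscreteTopologyDualNumber : DiscreteTopology (DualNumber ℤ) :=
  inferInstanceAs (DiscreteTopology (ℤ × ℤ))

theorem continuous_map_of_discrete {R S : Type*} [CommRing R] [CommRing S] [TopologicalSpace R]
    [DiscreteTopology R] [TopologicalSpace S] (f : R →+* S) :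
    Continuous (PowerSeries.map f) := by
  rw [continuous_iff_continuousAt]
  intro x
  rw [ContinuousAt, PowerSeries.WithPiTopology.tendsto_iff_coeff_tendsto]
  intro d
  simp only [coeff_map]
  exact (continuous_of_discreteTopology.tendsto _).comp
    ((PowerSeries.WithPiTopology.continuous_coeff R d).tendsto x)

/-- The square-zero element of the dual numbers. -/
abbrev dualEps : DualNumber ℤ := DualNumber.eps

theorem thetaMonomial_dualNumber (s : ℕ) (k : ℤ) :
    thetaMonomial (-(C (1 + dualEps) * X ^ s))
      (-(C (1 - dualEps))) k =
      C (((((-1) ^ k : ℤˣ) : ℤ) : DualNumber ℤ) * (1 + (k : DualNumber ℤ) * dualEps)) *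
        X ^ (s * (k * (k + 1) / 2)).toNat := by
  have he : dualEps * dualEps = 0 := DualNumber.eps_mul_eps
  have hp : ∀ n : ℕ, (1 + dualEps) ^ n = 1 + (n : DualNumber ℤ) * dualEps := by
    intro n
    induction n with
    | zero => simp
    | succ n ih => rw [pow_succ, ih]; push_cast; linear_combination (n : DualNumber ℤ) * he
  have hm : ∀ n : ℕ, (1 - dualEps) ^ n = 1 - (n : DualNumber ℤ) * dualEps := by
    intro n
    induction n with
    | zero => simp
    | succ n ih => rw [pow_succ, ih]; push_cast; linear_combination (n : DualNumber ℤ) * he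
  obtain ⟨x, hx⟩ := Int.eq_ofNat_of_zero_le (tri_nonneg k)
  obtain ⟨y, hy⟩ := Int.eq_ofNat_of_zero_le (tri_nonneg' k)
  have h3 := two_mul_tri k
  have h4 := two_mul_tri' k
  rw [hx] at h3
  rw [hy] at h4
  have hk : k = x - y := by linarith
  have hs : ((-1) ^ k : ℤˣ) = (-1) ^ (x + y) := by
    rw [← zpow_natCast]
    refine units_zpow_eq _ _ _ ⟨-y, ?_⟩
    push_cast
    linarith
  rw [thetaMonomial, hx, hy, hs, ← Nat.cast_mul]
  simp only [Int.toNat_natCast]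
  rw [neg_pow, neg_pow (C _), mul_pow, ← map_pow, ← map_pow, hp, hm, hk]
  have e : (1 + ((x - y : ℤ) : DualNumber ℤ) * dualEps) =
      (1 + (x : DualNumber ℤ) * dualEps) * (1 - (y : DualNumber ℤ) * dualEps) := by
    push_cast
    linear_combination (x * y : DualNumber ℤ) * he
  rw [e]
  simp only [map_mul]
  push_cast
  simp only [map_pow, map_neg, map_one]
  ring

/-- Dual numbers replace differentiation of the triple product at z = 1. With a = -(1+ε)q and b =
-(1-ε), the factor 1 + b equals ε, and each remaining pair of factors is (1 - q^k)² because ε² = 0.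
The series side has terms (-1)^k (1 + kε) q^{k(k+1)/2}; compare ε-components. -/
theorem tsum_jacobi_cube {s : ℕ} (hs : 1 ≤ s) :
    latticeSum (fun k : ℤ => s * (k * (k + 1) / 2)) (fun k => k * (((-1) ^ k : ℤˣ) : ℤ)) =
      eulerE s ^ 3 := by
  have he : dualEps * dualEps = 0 := DualNumber.eps_mul_eps
  have hab : (-(C (1 + dualEps) * X ^ s)) *
      (-(C (1 - dualEps))) = X ^ s := by
    have : (C (1 + dualEps)) * (C (1 - dualEps)) = 1 := by
      rw [← map_mul, ← map_one C]
      congr 1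
    linear_combination X ^ s * this
  have h := jacobi_triple hs hab
  have hP : PowerSeries.map (Int.castRingHom (DualNumber ℤ)) (eulerE s) =
      ∏' k : ℕ, (1 - (X ^ s : (DualNumber ℤ)⟦X⟧) ^ (k + 1)) := by
    rw [eulerE, qPoch, (multipliable_qPoch (X ^ s) hs).map_tprod _ (continuous_map_of_discrete _)]
    refine tprod_congr fun k => ?_
    simp
    ring
  have hprod : (∏' k : ℕ, (1 + -(C (1 + dualEps) * X ^ s) * (X ^ s) ^ k)) *
      (∏' k : ℕ, (1 + -(C (1 - dualEps)) * (X ^ s) ^ k)) *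
        ∏' k : ℕ, (1 - (X ^ s : (DualNumber ℤ)⟦X⟧) ^ (k + 1)) =
      C dualEps * (∏' k : ℕ, (1 - (X ^ s : (DualNumber ℤ)⟦X⟧) ^ (k + 1))) ^ 3 := by
    have hm := multipliable_one_add_mul_pow hs
      (-(C (1 - dualEps)) * X ^ s)
    have h1 : (∏' k : ℕ, (1 + -(C (1 + dualEps) * X ^ s) * (X ^ s) ^ k)) *
        (∏' k : ℕ, (1 + -(C (1 - dualEps)) * (X ^ s) ^ (k + 1))) =
        (∏' k : ℕ, (1 - (X ^ s : (DualNumber ℤ)⟦X⟧) ^ (k + 1))) *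
        ∏' k : ℕ, (1 - (X ^ s : (DualNumber ℤ)⟦X⟧) ^ (k + 1)) := by
      rw [← (multipliable_one_add_mul_pow hs _).tprod_mul (hm.congr fun k => by ring),
        ← (multipliable_one_sub_pow_succ hs).tprod_mul (multipliable_one_sub_pow_succ hs)]
      refine tprod_congr fun k => ?_
      have hC : (C dualEps) * C dualEps = 0 := by
        rw [← map_mul, he, map_zero]
      simp only [map_add, map_sub, map_one]
      linear_combination -(X ^ s * (X ^ s) ^ k) ^ 2 * hC
    have h0 : 1 + -(C (1 - dualEps)) * (X ^ s) ^ 0 = C dualEps := by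
      simp
    have h2 : ∏' k : ℕ, (1 + -(C (1 - dualEps)) * (X ^ s) ^ k) = C dualEps *
        ∏' k : ℕ, (1 + -(C (1 - dualEps)) * (X ^ s) ^ (k + 1)) := by
      rw [tprod_eq_zero_mul' (hm.congr fun k => by ring), h0]
    rw [h2]
    linear_combination (C dualEps *
      ∏' k : ℕ, (1 - (X ^ s : (DualNumber ℤ)⟦X⟧) ^ (k + 1))) * h1
  rw [hprod, ← hP, ← map_pow] at h
  have hloc : LocFin (fun k : ℤ => s * (k * (k + 1) / 2))
      (fun k => k * (((-1) ^ k : ℤˣ) : ℤ)) := by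
    have := locFin_theta (i := s) (j := 0) (by lia) (fun k => k * (((-1) ^ k : ℤˣ) : ℤ))
    have hw : thetaExp s (0 : ℕ) = fun k : ℤ => s * (k * (k + 1) / 2) := by
      funext k
      simp [thetaExp]
    rwa [hw] at this
  ext d
  have h2 := ((PowerSeries.WithPiTopology.hasSum_iff_hasSum_coeff _).mp h d).map
    (TrivSqZeroExt.sndHom ℤ ℤ) continuous_of_discreteTopology
  rw [coeff_latticeSum hloc]
  have h3 : TrivSqZeroExt.sndHom ℤ ℤ (coeff d (C dualEps *
      PowerSeries.map (Int.castRingHom (DualNumber ℤ)) (eulerE s ^ 3))) =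
      coeff d (eulerE s ^ 3) := by
    rw [coeff_C_mul, coeff_map]
    simp
  rw [← h3, ← h2.tsum_eq]
  refine tsum_congr fun k => ?_
  rw [Function.comp_apply, thetaMonomial_dualNumber, coeff_C_mul, coeff_X_pow]
  split_ifs <;> simp [mul_comm]

/-! ### The Appell–Lerch sum as a double series -/

/-- The coefficients `[0 ≤ i] - [n < 0]` of the indefinite double series. -/
def appellSign (n i : ℤ) : ℤ := (if 0 ≤ i then 1 else 0) - (if n < 0 then 1 else 0)

theorem appellSign_ne_zero {n i : ℤ} (h : appellSign n i ≠ 0) :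
    (0 ≤ n ∧ 0 ≤ i) ∨ (n < 0 ∧ i < 0) := by
  rw [appellSign] at h
  split_ifs at h <;> lia

/-- One formula covers ∑_{i≥0} q^{mi} for m > 0 and -∑_{i<0} q^{mi} for m < 0. Both sides satisfy
f(l) = f(l - m) + [l = 0] and vanish for l < 0, so their difference is |m|-periodic and vanishes far
to the left. -/
theorem coeff_inverse_one_sub_single {m : ℤ} (hm : m ≠ 0) (l : ℤ) :
    (Ring.inverse (1 - HahnSeries.single m (1 : ℤ)) : LaurentSeries ℤ).coeff l =
      if m ∣ l then appellSign m (l / m) else 0 := by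
  obtain ⟨hu, ho⟩ := isUnit_one_sub_single hm
  set V : LaurentSeries ℤ := Ring.inverse (1 - HahnSeries.single m (1 : ℤ)) with hV
  have hVu : IsUnit V := hu.ringInverse
  have hmul : V - HahnSeries.single m (1 : ℤ) * V = 1 := by
    rw [← Ring.mul_inverse_cancel _ hu, ← hV]
    ring
  have hio := HahnSeries.order_mul hu.ne_zero hVu.ne_zero
  rw [hV, Ring.mul_inverse_cancel _ hu, HahnSeries.order_one, ho, ← hV] at hio
  have hneg : ∀ l < 0, V.coeff l = 0 := fun l hl =>
    HahnSeries.coeff_eq_zero_of_lt_order (by lia)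
  have hrec : ∀ l, V.coeff l = V.coeff (l - m) + if l = 0 then 1 else 0 := by
    intro l
    have := congrArg (fun f => HahnSeries.coeff f l) hmul
    simp only [HahnSeries.coeff_sub, HahnSeries.coeff_one] at this
    rw [HahnSeries.coeff_single_mul, one_mul] at this
    split_ifs at this ⊢ <;> linarith
  set g : ℤ → ℤ := fun l => if m ∣ l then appellSign m (l / m) else 0 with hg
  have gneg : ∀ l < 0, g l = 0 := by
    intro l hl
    simp only [hg]
    split_ifs with h
    · obtain ⟨j, rfl⟩ := h
      rw [Int.mul_ediv_cancel_left _ hm, appellSign]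
      split_ifs <;> first | rfl | nlinarith
    · rfl
  have grec : ∀ l, g l = g (l - m) + if l = 0 then 1 else 0 := by
    intro l
    simp only [hg]
    by_cases h : m ∣ l
    · obtain ⟨j, rfl⟩ := h
      rw [if_pos (dvd_mul_right _ _), if_pos (Dvd.intro (j - 1) (by ring)),
        show m * j - m = m * (j - 1) by ring, Int.mul_ediv_cancel_left _ hm,
        Int.mul_ediv_cancel_left _ hm, appellSign, appellSign]
      simp only [mul_eq_zero, hm, false_or]
      split_ifs <;> lia
    · rw [if_neg h, if_neg (fun h' => h (by simpa using dvd_add h' (dvd_refl m))), if_neg]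
      · rfl
      · rintro rfl
        exact h (dvd_zero m)
  have hper : ∀ l, V.coeff l - g l = V.coeff (l - |m|) - g (l - |m|) := by
    intro l
    rcases abs_cases m with ⟨h, _⟩ | ⟨h, _⟩ <;> rw [h]
    · rw [hrec, grec l]; ring
    · have h1 := hrec (l - -m)
      have h2 := grec (l - -m)
      rw [show l - -m - m = l by ring] at h1 h2
      rw [h1, h2]; ring
  have hper' : ∀ (j : ℕ) l, V.coeff l - g l = V.coeff (l - j * |m|) - g (l - j * |m|) := by
    intro j
    induction j with
    | zero => simp
    | succ j ih =>
      intro l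
      rw [ih, hper]
      push_cast
      rw [show l - j * |m| - |m| = l - (j + 1) * |m| by ring]
  have hz : l - (l.natAbs + 1 : ℕ) * |m| < 0 := by
    have := abs_pos.mpr hm
    push_cast
    have h2 : l ≤ |l| := le_abs_self l
    have h3 := abs_nonneg l
    nlinarith
  have := hper' (l.natAbs + 1) l
  rw [hneg _ hz, gneg _ hz] at this
  linarith

theorem coeff_appellLerchTerm (n k : ℤ) : (appellLerchTerm 1 10 n).coeff k =
    if 10 * n + 1 ∣ k - (5 * (n ^ 2 + n) + n + 1) then
      appellSign n ((k - (5 * (n ^ 2 + n) + n + 1)) / (10 * n + 1)) * (((-1) ^ n : ℤˣ) : ℤ)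
    else 0 := by
  have h2 := two_mul_tri n
  have he : ((10 : ℕ) : ℤ) * (n * (n + 1) / 2) + (1 : ℕ) * n + (1 : ℕ) =
      5 * (n ^ 2 + n) + n + 1 := by
    push_cast
    linear_combination 5 * h2
  have hs : ∀ i, appellSign (10 * n + 1) i = appellSign n i := by
    intro i
    rw [appellSign, appellSign]
    congr 2
    exact propext (by lia)
  rw [appellLerchTerm, he, HahnSeries.coeff_single_mul]
  push_cast
  rw [coeff_inverse_one_sub_single (by lia)]
  simp only [hs]
  split_ifs
  · exact mul_comm _ _
  · exact mul_zero _

/-- The coefficients of the double series `∑ ± (-1)^n X^{w(n,i)}`. -/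
def doubleCoeff (x : ℤ × ℤ) : ℤ := appellSign x.1 x.2 * (((-1) ^ x.1 : ℤˣ) : ℤ)

theorem doubleCoeff_ne_zero {n i : ℤ} (h : doubleCoeff (n, i) ≠ 0) :
    (0 ≤ n ∧ 0 ≤ i) ∨ (n < 0 ∧ i < 0) :=
  appellSign_ne_zero (left_ne_zero_of_mul h)

/-- The exponent in the double series for the Appell–Lerch sum. -/
def appellExp (x : ℤ × ℤ) : ℤ := 5 * (x.1 ^ 2 + x.1) + x.1 + 1 + (10 * x.1 + 1) * x.2

theorem appellExp_bound {n i : ℤ} (h : doubleCoeff (n, i) ≠ 0) :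
    |n| ≤ appellExp (n, i) ∧ |i| ≤ appellExp (n, i) := by
  simp only [appellExp]
  rcases doubleCoeff_ne_zero h with ⟨h1, h2⟩ | ⟨h1, h2⟩
  · rw [abs_of_nonneg h1, abs_of_nonneg h2]
    constructor <;> nlinarith [mul_nonneg h1 h2]
  · rw [abs_of_neg h1, abs_of_neg h2]
    constructor <;> nlinarith [mul_nonneg (show 0 ≤ -n - 1 by lia) (show 0 ≤ -i - 1 by lia)]

theorem locFin_appellExp : LocFin appellExp doubleCoeff :=
  LocFin.of_bound₂ 0 fun _ _ h => by simpa using appellExp_bound h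

theorem appellLerchSum_eq : appellLerchSum 1 10 = latticeSum appellExp doubleCoeff := by
  ext d
  rw [coeff_latticeSum locFin_appellExp]
  have hsum : Summable fun x : ℤ × ℤ => if d = (appellExp x).toNat then doubleCoeff x else 0 := by
    apply summable_of_hasFiniteSupport
    refine (locFin_appellExp d).subset fun x hx => ?_
    rw [Function.mem_support] at hx
    split_ifs at hx with h
    · exact ⟨hx, by lia⟩
    · exact absurd rfl hx
  rw [hsum.tsum_prod, appellLerchSum, coeff_mk, ← tsum_eq_finsum (L := .unconditional ℤ)]
  · refine tsum_congr fun n => ?_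
    rw [coeff_appellLerchTerm]
    have hm : 10 * n + 1 ≠ 0 := by lia
    have hiff : ∀ i, (if d = (appellExp (n, i)).toNat then doubleCoeff (n, i) else 0) =
        if (d : ℤ) - (5 * (n ^ 2 + n) + n + 1) = (10 * n + 1) * i then doubleCoeff (n, i)
          else 0 := by
      intro i
      by_cases h0 : doubleCoeff (n, i) = 0
      · simp [h0]
      · have hb := (appellExp_bound h0).1.trans' (abs_nonneg n)
        refine if_congr ?_ rfl rfl
        simp only [appellExp] at hb ⊢
        constructor <;> intro h <;> lia
    simp only [hiff]
    split_ifs with h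
    · obtain ⟨j, hj⟩ := h
      rw [hj, Int.mul_ediv_cancel_left _ hm, tsum_eq_single j]
      · rw [if_pos rfl, doubleCoeff]
      · intro i hi
        rw [if_neg]
        intro h'
        exact hi (mul_left_cancel₀ hm h').symm
    · symm
      convert tsum_zero with i
      rw [if_neg]
      intro h'
      exact h ⟨i, h'⟩
  · refine (Set.finite_Icc (-(d : ℤ)) d).subset fun n hn => ?_
    rw [Function.mem_support] at hn
    by_contra hc
    refine hn (appellLerchTerm_coeff_eq_zero (by norm_num) (by norm_num) ?_)
    by_contra hlt
    exact hc (abs_le.mp (not_lt.mp hlt))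

/-! ### Evaluation of the double series -/

/-- The exponent in the double series `∑ ± (-1)^n X^{5n(n+1) + (10n+1)i}`. -/
def lambdaExp (x : ℤ × ℤ) : ℤ := 5 * (x.1 ^ 2 + x.1) + (10 * x.1 + 1) * x.2

theorem lambdaExp_bound {n i : ℤ} (h : doubleCoeff (n, i) ≠ 0) :
    |n| ≤ lambdaExp (n, i) ∧ |i| ≤ lambdaExp (n, i) := by
  simp only [lambdaExp]
  rcases doubleCoeff_ne_zero h with ⟨h1, h2⟩ | ⟨h1, h2⟩
  · rw [abs_of_nonneg h1, abs_of_nonneg h2]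
    constructor <;> nlinarith [mul_nonneg h1 h2]
  · rw [abs_of_neg h1, abs_of_neg h2]
    constructor <;> nlinarith [mul_nonneg (show 0 ≤ -n - 1 by lia) (show 0 ≤ -i - 1 by lia)]

theorem lambdaExp_nonneg (x : ℤ × ℤ) (h : doubleCoeff x ≠ 0) : 0 ≤ lambdaExp x :=
  (abs_nonneg x.1).trans (lambdaExp_bound h).1

theorem locFin_lambdaExp : LocFin lambdaExp doubleCoeff :=
  LocFin.of_bound₂ 0 fun _ _ h => by simpa using lambdaExp_bound h

theorem latticeSum_fiber {ι κ : Type*} {w c : ι × κ → ℤ} (h : LocFin w c) :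
    latticeSum w c = ∑' i, latticeSum (fun k => w (i, k)) (fun k => c (i, k)) :=
  h.summable.tsum_prod' fun i =>
    (h.comp_injective (g := fun k : κ => (i, k)) fun _ _ h => (Prod.ext_iff.mp h).2).summable

/-- The involution `(N, i) ↦ (a - N, b - i)`. -/
def reflection (a b : ℤ) : ℤ × ℤ ≃ ℤ × ℤ := (Equiv.subLeft a).prodCongr (Equiv.subLeft b)

theorem reflection_apply (a b : ℤ) (x : ℤ × ℤ) : reflection a b x = (a - x.1, b - x.2) := rfl

/-- The exponent on the fibre over `k` of the product of the double series with a theta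
function. -/
def fiberExp (k : ℤ) (x : ℤ × ℤ) : ℤ :=
  5 * x.1 ^ 2 + 5 * x.1 + 5 * k ^ 2 - 4 * k - 10 * k * x.2

/-- The coefficients on the fibre over `k`. -/
def fiberCoeff (k : ℤ) (x : ℤ × ℤ) : ℤ :=
  appellSign (x.1 - x.2) x.2 * (((-1) ^ (x.1 + k) : ℤˣ) : ℤ)

/-- The shear `(k, (N, i)) ↦ ((N - i, i), k - i)`. -/
def shear : ℤ × (ℤ × ℤ) ≃ (ℤ × ℤ) × ℤ where
  toFun x := ((x.2.1 - x.2.2, x.2.2), x.1 - x.2.2)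
  invFun y := (y.2 + y.1.2, (y.1.1 + y.1.2, y.1.2))
  left_inv x := by simp
  right_inv y := by simp

theorem shear_exp (x : ℤ × (ℤ × ℤ)) :
    lambdaExp (shear x).1 + thetaExp (1 : ℕ) (9 : ℕ) (shear x).2 = fiberExp x.1 x.2 := by
  refine eq_of_two_mul_eq ?_
  simp only [mul_add, two_mul_thetaExp, lambdaExp, fiberExp, shear, Equiv.coe_fn_mk]
  push_cast
  ring

theorem shear_coeff (x : ℤ × (ℤ × ℤ)) :
    doubleCoeff (shear x).1 * (((-1) ^ (shear x).2 : ℤˣ) : ℤ) = fiberCoeff x.1 x.2 := by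
  simp only [doubleCoeff, fiberCoeff, shear, Equiv.coe_fn_mk]
  rw [mul_assoc, ← Units.val_mul, ← zpow_add, neg_one_zpow_congr (l := x.2.1 + x.1) (by lia)]

theorem locFin_fiber :
    LocFin (fun x : ℤ × (ℤ × ℤ) => fiberExp x.1 x.2) (fun x => fiberCoeff x.1 x.2) := by
  have := (locFin_lambdaExp.prod (locFin_theta (i := 1) (j := 9) (by lia)
    fun k => (((-1) ^ k : ℤˣ) : ℤ)) lambdaExp_nonneg
    fun _ _ => thetaExp_nonneg _ _ _).comp_injective shear.injective
  simpa only [shear_exp, shear_coeff] using this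

theorem fiberExp_nonneg (k : ℤ) (x : ℤ × ℤ) (h : fiberCoeff k x ≠ 0) : 0 ≤ fiberExp k x := by
  rw [← shear_coeff (k, x)] at h
  rw [← shear_exp (k, x)]
  exact add_nonneg (lambdaExp_nonneg _ (left_ne_zero_of_mul h)) (thetaExp_nonneg _ _ _)

/-- The shift i ↦ i + 1 multiplies the monomials by q^{-10k} and changes the coefficients only on
the lines i = -1 and i = N. Each boundary sum cancels under a reflection, so (q^L - q^K) S = 0 with
L ≠ K. -/
theorem latticeSum_fiber_eq_zero {k : ℤ} (hk : k ≠ 0) :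
    latticeSum (fiberExp k) (fiberCoeff k) = 0 := by
  have hloc : LocFin (fiberExp k) (fiberCoeff k) :=
    locFin_fiber.comp_injective (g := fun x : ℤ × ℤ => (k, x)) fun _ _ h => (Prod.ext_iff.mp h).2
  -- L - K = 10k; the common term 10|k| makes both natural numbers, so the shift by q^{-10k} needs
  -- no negative powers.
  obtain ⟨K, hK⟩ := Int.eq_ofNat_of_zero_le (show 0 ≤ 10 * |k| by positivity)
  obtain ⟨L, hL⟩ := Int.eq_ofNat_of_zero_le (show 0 ≤ 10 * |k| + 10 * k by
    have := neg_abs_le k; lia)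
  let up : ℤ × ℤ ≃ ℤ × ℤ := (Equiv.refl ℤ).prodCongr (Equiv.addRight (1 : ℤ))
  have hup : ∀ x : ℤ × ℤ, fiberExp k (up x) + L = fiberExp k x + K := by
    intro x
    simp only [fiberExp, up, Equiv.prodCongr_apply, Prod.map, Equiv.refl_apply,
      Equiv.coe_addRight]
    linear_combination hK - hL
  have h1 : X ^ L * latticeSum (fiberExp k) (fiberCoeff k) =
      latticeSum (fun x => fiberExp k x + K) fun x => fiberCoeff k (up x) := by
    rw [X_pow_mul_latticeSum _ hloc (fiberExp_nonneg k), ← latticeSum_equiv up]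
    simp only [hup]
  have hlocup : LocFin (fun x => fiberExp k x + K) fun x => fiberCoeff k (up x) := by
    have := (hloc.add_const L).comp_injective up.injective
    simpa only [hup] using this
  have hdiff : ∀ x : ℤ × ℤ, fiberCoeff k (up x) - fiberCoeff k x =
      (if x.2 = -1 then (((-1) ^ (x.1 + k) : ℤˣ) : ℤ) else 0) -
        (if x.2 = x.1 then (((-1) ^ (x.1 + k) : ℤˣ) : ℤ) else 0) := by
    intro x
    simp only [fiberCoeff, up, Equiv.prodCongr_apply, Prod.map, Equiv.refl_apply,
      Equiv.coe_addRight, appellSign]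
    generalize (((-1) ^ (x.1 + k) : ℤˣ) : ℤ) = u
    split_ifs <;> lia
  have habs : ∀ M : ℤ, |M| - 1 ≤ 5 * M ^ 2 + 5 * M := by
    intro M
    rcases abs_cases M with ⟨h, _⟩ | ⟨h, _⟩ <;> rw [h] <;> nlinarith
  have hA : LocFin (fun x => fiberExp k x + K)
      fun x => if x.2 = -1 then (((-1) ^ (x.1 + k) : ℤˣ) : ℤ) else 0 := by
    refine LocFin.of_bound₂ 1 fun N i h => ?_
    have : i = -1 := by
      by_contra hne
      simp [hne] at h
    subst this
    have h4 : 0 ≤ |k| + k := by have := neg_abs_le k; lia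
    have h5 := habs N
    have h6 := abs_nonneg N
    have h7 := sq_nonneg k
    simp only [fiberExp]
    rw [← hK]
    constructor
    · lia
    · rw [abs_neg, abs_one]
      lia
  have hB : LocFin (fun x => fiberExp k x + K)
      fun x => if x.2 = x.1 then (((-1) ^ (x.1 + k) : ℤˣ) : ℤ) else 0 := by
    refine LocFin.of_bound₂ 1 fun N i h => ?_
    obtain rfl : i = N := by
      by_contra hne
      simp [hne] at h
    rw [and_self]
    have h4 : 0 ≤ |k| + k := by have := neg_abs_le k; lia
    have h5 := habs (i - k)
    have h6 := abs_sub_abs_le_abs_sub i k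
    simp only [fiberExp]
    rw [← hK]
    have := abs_nonneg k
    linarith
  have hA0 : latticeSum (fun x => fiberExp k x + K)
      (fun x => if x.2 = -1 then (((-1) ^ (x.1 + k) : ℤˣ) : ℤ) else 0) = 0 := by
    refine latticeSum_eq_zero (reflection (-1) (-2)) (fun x hx => ?_) fun x => ?_
    · have : x.2 = -1 := by
        by_contra hne
        simp [hne] at hx
      simp only [fiberExp, reflection_apply, this]
      ring
    · simp only [reflection_apply]
      rw [neg_one_zpow_eq_neg (k := -1 - x.1 + k) (l := x.1 + k) (by lia)]
      have : -2 - x.2 = -1 ↔ x.2 = -1 := by lia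
      simp only [this]
      split_ifs <;> simp
  have hB0 : latticeSum (fun x => fiberExp k x + K)
      (fun x => if x.2 = x.1 then (((-1) ^ (x.1 + k) : ℤˣ) : ℤ) else 0) = 0 := by
    refine latticeSum_eq_zero (reflection (2 * k - 1) (2 * k - 1)) (fun x hx => ?_) fun x => ?_
    · have : x.2 = x.1 := by
        by_contra hne
        simp [hne] at hx
      simp only [fiberExp, reflection_apply, this]
      ring
    · simp only [reflection_apply]
      rw [neg_one_zpow_eq_neg (k := 2 * k - 1 - x.1 + k) (l := x.1 + k) (by lia)]
      have : 2 * k - 1 - x.2 = 2 * k - 1 - x.1 ↔ x.2 = x.1 := by lia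
      simp only [this]
      split_ifs <;> simp
  have hsub : (X ^ L - X ^ K) * latticeSum (fiberExp k) (fiberCoeff k) = 0 := by
    rw [sub_mul, h1, X_pow_mul_latticeSum _ hloc (fiberExp_nonneg k),
      ← latticeSum_sub hlocup (hloc.add_const K)]
    simp only [hdiff]
    rw [latticeSum_sub hA hB, hA0, hB0, sub_zero]
  refine (mul_eq_zero.mp hsub).resolve_left fun h => ?_
  have hLK : L ≠ K := by lia
  have := congrArg (coeff L) h
  rw [map_sub, coeff_X_pow, coeff_X_pow, if_pos rfl, if_neg hLK, map_zero] at this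
  norm_num at this

/-- The sign is +1 on 0 ≤ i ≤ N, or -1 on N < i < 0. Either way the total is N + 1. -/
theorem tsum_appellSign (N : ℤ) (Y : ℤ⟦X⟧) :
    ∑' i : ℤ, C (appellSign (N - i) i) * Y = C (N + 1) * Y := by
  rcases lt_or_ge N 0 with h | h
  · rw [tsum_eq_sum (s := Finset.Ioo N 0) fun i hi => ?_]
    · rw [← Finset.sum_mul, ← map_sum, Finset.sum_congr rfl (g := fun _ => (-1 : ℤ)) fun i hi => ?_]
      swap
      · rw [Finset.mem_Ioo] at hi
        rw [appellSign, if_neg (by lia), if_pos (by lia)]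
        rfl
      rw [Finset.sum_const, Int.card_Ioo]
      congr 2
      rw [nsmul_eq_mul]
      lia
    · rw [Finset.mem_Ioo] at hi
      have : appellSign (N - i) i = 0 := by rw [appellSign]; split_ifs <;> lia
      rw [this, map_zero, zero_mul]
  · rw [tsum_eq_sum (s := Finset.Icc 0 N) fun i hi => ?_]
    · rw [← Finset.sum_mul, ← map_sum, Finset.sum_congr rfl (g := fun _ => (1 : ℤ)) fun i hi => ?_]
      swap
      · rw [Finset.mem_Icc] at hi
        rw [appellSign, if_pos (by lia), if_neg (by lia)]
        rfl
      rw [Finset.sum_const, Int.card_Icc]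
      congr 2
      rw [nsmul_eq_mul]
      lia
    · rw [Finset.mem_Icc] at hi
      have : appellSign (N - i) i = 0 := by rw [appellSign]; split_ifs <;> lia
      rw [this, map_zero, zero_mul]

/-- In the coordinates of `shear` only the fibre k = 0 survives. It equals ∑ (-1)^N (N+1)
q^{5N(N+1)}, where the N part is Jacobi's cube and the constant part cancels under N ↦ -1 - N. -/
theorem latticeSum_lambda_mul_theta :
    latticeSum lambdaExp doubleCoeff * theta (-1) 1 9 = eulerE 10 ^ 3 := by
  rw [theta, latticeSum_mul locFin_lambdaExp (locFin_theta (by lia) _) lambdaExp_nonneg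
    fun _ _ => thetaExp_nonneg _ _ _, ← latticeSum_equiv shear]
  simp only [shear_exp, shear_coeff]
  rw [latticeSum_fiber locFin_fiber, tsum_eq_single 0 fun k hk => latticeSum_fiber_eq_zero hk,
    latticeSum_fiber (locFin_fiber.comp_injective (g := fun x : ℤ × ℤ => ((0 : ℤ), x))
      fun _ _ h => (Prod.ext_iff.mp h).2)]
  have hw : ∀ N : ℤ, 5 * N ^ 2 + 5 * N = 10 * (N * (N + 1) / 2) := fun N => by
    have := two_mul_tri N
    linear_combination -5 * this
  have hN : ∀ N : ℤ, latticeSum (fun i => fiberExp 0 (N, i)) (fun i => fiberCoeff 0 (N, i)) =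
      C (N * (((-1) ^ N : ℤˣ) : ℤ) + (((-1) ^ N : ℤˣ) : ℤ)) *
        X ^ (((10 : ℕ) : ℤ) * (N * (N + 1) / 2)).toNat := by
    intro N
    have h1 := tsum_appellSign N (C (((-1) ^ N : ℤˣ) : ℤ) *
      X ^ (((10 : ℕ) : ℤ) * (N * (N + 1) / 2)).toNat)
    rw [← mul_assoc, ← map_mul, add_mul, one_mul] at h1
    rw [← h1, latticeSum]
    refine tsum_congr fun i => ?_
    rw [fiberCoeff, fiberExp]
    push_cast
    simp only [add_zero, map_mul, mul_assoc, ← hw]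
    congr 4
    ring
  simp only [hN]
  have hloc := fun c => locFin_theta (i := 10) (j := 0) (by lia) c
  have hth : thetaExp (10 : ℕ) (0 : ℕ) = fun k : ℤ => ((10 : ℕ) : ℤ) * (k * (k + 1) / 2) := by
    funext k
    simp [thetaExp]
  rw [hth] at hloc
  have := latticeSum_add (hloc fun k => k * (((-1) ^ k : ℤˣ) : ℤ)) (hloc fun k => (((-1) ^ k : ℤˣ) : ℤ))
  have hz : latticeSum (fun k : ℤ => ((10 : ℕ) : ℤ) * (k * (k + 1) / 2))
      (fun k => (((-1) ^ k : ℤˣ) : ℤ)) = 0 := by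
    refine latticeSum_eq_zero (Equiv.subLeft (-1 : ℤ)) (fun k _ => ?_) (fun k => ?_)
    · rw [Equiv.subLeft_apply, show (-1 - k) * (-1 - k + 1) = k * (k + 1) by ring]
    · rw [Equiv.subLeft_apply, ← Units.val_neg]
      exact congrArg Units.val (neg_one_zpow_eq_neg (by lia))
  rw [tsum_jacobi_cube (s := 10) (by norm_num), hz, add_zero] at this
  exact this

/-! ### The odd part of the Appell–Lerch series -/

/-- `∑ f(2n+1) X^n`. -/
def oddPart (f : ℤ⟦X⟧) : ℤ⟦X⟧ := PowerSeries.mk fun n => coeff (2 * n + 1) f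

theorem oddPart_eq_iff (f g : ℤ⟦X⟧) :
    oddPart f = g ↔ ∃ h, f = expand 2 two_ne_zero h + X * expand 2 two_ne_zero g := by
  constructor
  · rintro rfl
    refine ⟨PowerSeries.mk fun n => coeff (2 * n) f, ?_⟩
    ext d
    rw [map_add]
    rcases Nat.even_or_odd' d with ⟨m, rfl | rfl⟩
    · rw [coeff_expand_mul, coeff_mk]
      rcases m with _ | m
      · simp
      · rw [show 2 * (m + 1) = 2 * m + 1 + 1 by ring, coeff_succ_X_mul,
          coeff_expand_of_not_dvd _ _ _ (by lia), add_zero]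
    · rw [coeff_succ_X_mul, coeff_expand_mul, coeff_expand_of_not_dvd _ _ _ (by lia), zero_add,
        oddPart, coeff_mk]
  · rintro ⟨h, rfl⟩
    ext n
    rw [oddPart, coeff_mk, map_add, coeff_succ_X_mul, coeff_expand_mul,
      coeff_expand_of_not_dvd _ _ _ (by lia), zero_add]

theorem oddPart_mul_expand (f g : ℤ⟦X⟧) :
    oddPart (f * expand 2 two_ne_zero g) = oddPart f * g := by
  obtain ⟨h, hh⟩ := (oddPart_eq_iff f _).mp rfl
  refine (oddPart_eq_iff _ _).mpr ⟨h * g, ?_⟩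
  rw [map_mul, map_mul]
  linear_combination expand 2 two_ne_zero g * hh

theorem expand_latticeSum {ι : Type*} {w c : ι → ℤ} (h : LocFin w c)
    (h0 : ∀ i, c i ≠ 0 → 0 ≤ w i) :
    expand 2 two_ne_zero (latticeSum w c) = latticeSum (fun i => 2 * w i) c := by
  have h2 : LocFin (fun i => 2 * w i) c := fun d =>
    (h d).subset fun i hi => ⟨hi.1, by have := h0 i hi.1; have := hi.2; lia⟩
  ext d
  rw [coeff_latticeSum h2]
  rcases Nat.even_or_odd' d with ⟨m, rfl | rfl⟩
  · rw [coeff_expand_mul, coeff_latticeSum h]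
    refine tsum_congr fun i => if_congr ?_ rfl rfl
    lia
  · rw [coeff_expand_of_not_dvd _ _ _ (by lia)]
    symm
    convert tsum_zero with i
    exact if_neg (by lia)

theorem expand_theta (s : ℤˣ) {i j : ℕ} (h : 1 ≤ i + j) :
    expand 2 two_ne_zero (theta s i j) = theta s (2 * i) (2 * j) := by
  rw [theta, expand_latticeSum (locFin_theta h _) fun _ _ => thetaExp_nonneg _ _ _, theta]
  refine latticeSum_congr (fun _ => rfl) fun k _ => ?_
  simp only [thetaExp]
  push_cast
  ring

/-- The exponent in the product of `f(X, X^4)` and the double series. -/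
def oddExp (x : ℤ × (ℤ × ℤ)) : ℤ := thetaExp (1 : ℕ) (4 : ℕ) x.1 + lambdaExp x.2

/-- The two halves of the splitting of `(ℤ × ℤ) × ℤ` by the parity of `i + m + n`. -/
def parityMap : Fin 2 → ℤ × (ℤ × ℤ) → (ℤ × ℤ) × ℤ :=
  ![fun y => ((y.2.1, y.1 + 2 * y.2.2), y.1 - y.2.1),
    fun y => ((y.2.1, y.1 + 2 * y.2.2 + 1), y.1 - y.2.1)]

theorem parityMap_zero (y : ℤ × (ℤ × ℤ)) :
    parityMap 0 y = ((y.2.1, y.1 + 2 * y.2.2), y.1 - y.2.1) := rfl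

theorem parityMap_one (y : ℤ × (ℤ × ℤ)) :
    parityMap 1 y = ((y.2.1, y.1 + 2 * y.2.2 + 1), y.1 - y.2.1) := rfl

theorem bijective_parityMap :
    Function.Bijective fun x : Fin 2 × (ℤ × (ℤ × ℤ)) => parityMap x.1 x.2 := by
  constructor
  · rintro ⟨r, s, n, i⟩ ⟨r', s', n', i'⟩ h
    fin_cases r <;> fin_cases r' <;> simp [Prod.ext_iff, parityMap] at h ⊢ <;> lia
  · rintro ⟨⟨n, i⟩, m⟩
    rcases Int.even_or_odd' (i - m - n) with ⟨u, h | h⟩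
    · exact ⟨(0, m + n, n, u), by simp [Prod.ext_iff, parityMap]; lia⟩
    · exact ⟨(1, m + n, n, u), by simp [Prod.ext_iff, parityMap]; lia⟩

theorem locFin_appell_theta :
    LocFin (fun x : (ℤ × ℤ) × ℤ => appellExp x.1 + thetaExp (1 : ℕ) (9 : ℕ) x.2)
      (fun x => doubleCoeff x.1 * (((1 : ℤˣ) ^ x.2 : ℤˣ) : ℤ)) :=
  locFin_appellExp.prod (locFin_theta (by lia) fun k => (((1 : ℤˣ) ^ k : ℤˣ) : ℤ))
    (fun x h => (abs_nonneg x.1).trans (appellExp_bound h).1) fun _ _ => thetaExp_nonneg _ _ _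

theorem parityMap_exp_zero (x : ℤ × (ℤ × ℤ)) :
    appellExp (parityMap 0 x).1 + thetaExp (1 : ℕ) (9 : ℕ) (parityMap 0 x).2 =
      2 * oddExp x + 1 := by
  have h1 := two_mul_thetaExp (1 : ℕ) (4 : ℕ) x.1
  have h2 := two_mul_thetaExp (1 : ℕ) (9 : ℕ) (x.1 - x.2.1)
  simp only [appellExp, oddExp, lambdaExp, parityMap_zero]
  push_cast at *
  linarith

theorem parityMap_exp_one (x : ℤ × (ℤ × ℤ)) :
    appellExp (parityMap 1 x).1 + thetaExp (1 : ℕ) (9 : ℕ) (parityMap 1 x).2 =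
      2 * (oddExp x + 5 * x.2.1 + 1) := by
  have h1 := two_mul_thetaExp (1 : ℕ) (4 : ℕ) x.1
  have h2 := two_mul_thetaExp (1 : ℕ) (9 : ℕ) (x.1 - x.2.1)
  simp only [appellExp, oddExp, lambdaExp, parityMap_one]
  push_cast at *
  linarith

theorem locFin_parityMap (r : Fin 2) :
    LocFin (fun x => appellExp (parityMap r x).1 + thetaExp (1 : ℕ) (9 : ℕ) (parityMap r x).2)
      (fun x => doubleCoeff (parityMap r x).1) := by
  have := locFin_appell_theta.comp_injective (g := parityMap r) fun x y h =>
    (Prod.ext_iff.mp (bijective_parityMap.1 (a₁ := (r, x)) (a₂ := (r, y)) h)).2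
  simpa using this

theorem parityMap_exp_nonneg {r : Fin 2} {x : ℤ × (ℤ × ℤ)} (h : doubleCoeff (parityMap r x).1 ≠ 0) :
    0 ≤ appellExp (parityMap r x).1 + thetaExp (1 : ℕ) (9 : ℕ) (parityMap r x).2 :=
  add_nonneg ((abs_nonneg _).trans (appellExp_bound h).1) (thetaExp_nonneg _ _ _)

theorem locFin_of_two_mul {ι : Type*} {w c : ι → ℤ} (k : ℤ) (h : LocFin (fun i => 2 * w i + k) c) :
    LocFin w c := fun d => (h (2 * d + k)).subset fun i hi => ⟨hi.1, by have := hi.2; lia⟩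

/-- The total exponent is odd exactly when i - m - n is even, which is class 0 of `parityMap`. There
it equals 2 · `oddExp` + 1. -/
theorem oddPart_appellLerchSum_mul_theta :
    oddPart (appellLerchSum 1 10 * theta 1 1 9) =
      latticeSum oddExp fun x => doubleCoeff (parityMap 0 x).1 := by
  have h0 := locFin_parityMap 0
  have h1 := locFin_parityMap 1
  simp only [parityMap_exp_zero] at h0
  simp only [parityMap_exp_one] at h1
  have h0' := locFin_of_two_mul 1 h0
  have h1' := locFin_of_two_mul (w := fun x => oddExp x + 5 * x.2.1 + 1) 0 (by simpa using h1)
  have n0 : ∀ x, doubleCoeff (parityMap 0 x).1 ≠ 0 → 0 ≤ oddExp x := fun x hx => by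
    have := parityMap_exp_nonneg hx
    rw [parityMap_exp_zero] at this
    lia
  have n1 : ∀ x, doubleCoeff (parityMap 1 x).1 ≠ 0 → 0 ≤ oddExp x + 5 * x.2.1 + 1 := fun x hx => by
    have := parityMap_exp_nonneg hx
    rw [parityMap_exp_one] at this
    lia
  rw [oddPart_eq_iff, expand_latticeSum h0' n0]
  refine ⟨latticeSum (fun x => oddExp x + 5 * x.2.1 + 1) fun x => doubleCoeff (parityMap 1 x).1, ?_⟩
  rw [expand_latticeSum h1' n1, appellLerchSum_eq, theta, latticeSum_mul locFin_appellExp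
    (locFin_theta (by lia) _) (fun x h => (abs_nonneg x.1).trans (appellExp_bound h).1)
    fun _ _ => thetaExp_nonneg _ _ _, latticeSum_partition locFin_appell_theta _
    bijective_parityMap, Fin.sum_univ_two]
  simp only [parityMap_exp_zero, parityMap_exp_one, one_zpow, Units.val_one, mul_one]
  have hX := X_pow_mul_latticeSum 1 (w := fun x => 2 * oddExp x)
    (c := fun x => doubleCoeff (parityMap 0 x).1)
    (fun d => (h0 (d + 1)).subset fun i hi => ⟨hi.1, by have := hi.2; lia⟩)
    fun x hx => by have := n0 x hx; lia
  rw [pow_one, Nat.cast_one] at hX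
  rw [hX, add_comm]

/-- The two coefficients differ by ([0 ≤ s+2i] - [0 ≤ i]) (-1)^n. The bracket does not involve n,
while n ↦ -(n+1+2i) preserves the exponent and reverses (-1)^n, so the difference sums to zero. -/
theorem latticeSum_oddExp :
    (latticeSum oddExp fun x => doubleCoeff (parityMap 0 x).1) =
      theta 1 1 4 * latticeSum lambdaExp doubleCoeff := by
  have h0 := locFin_parityMap 0
  simp only [parityMap_exp_zero] at h0
  have h0' := locFin_of_two_mul 1 h0
  have h2 : LocFin oddExp (fun x => (((1 : ℤˣ) ^ x.1 : ℤˣ) : ℤ) * doubleCoeff x.2) :=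
    (locFin_theta (i := 1) (j := 4) (by lia) fun k => (((1 : ℤˣ) ^ k : ℤˣ) : ℤ)).prod
      locFin_lambdaExp (fun _ _ => thetaExp_nonneg _ _ _) lambdaExp_nonneg
  rw [theta, latticeSum_mul (locFin_theta (by lia) _) locFin_lambdaExp
    (fun _ _ => thetaExp_nonneg _ _ _) lambdaExp_nonneg, ← sub_eq_zero]
  change latticeSum oddExp _ - latticeSum oddExp _ = 0
  rw [← latticeSum_sub h0' h2]
  let σ : ℤ × (ℤ × ℤ) ≃ ℤ × (ℤ × ℤ) :=
    { toFun := fun x => (x.1, (-(x.2.1 + 1 + 2 * x.2.2), x.2.2))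
      invFun := fun x => (x.1, (-(x.2.1 + 1 + 2 * x.2.2), x.2.2))
      left_inv := fun x => Prod.ext rfl (Prod.ext (by dsimp only; ring) rfl)
      right_inv := fun x => Prod.ext rfl (Prod.ext (by dsimp only; ring) rfl) }
  refine latticeSum_eq_zero σ (fun x _ => ?_) fun x => ?_
  · simp only [oddExp, lambdaExp, σ, Equiv.coe_fn_mk]
    ring
  · simp only [doubleCoeff, parityMap_zero, σ, Equiv.coe_fn_mk, one_zpow,
      Units.val_one, one_mul]
    rw [neg_one_zpow_eq_neg (k := -(x.2.1 + 1 + 2 * x.2.2)) (l := x.2.1) (by lia), appellSign,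
      appellSign, appellSign, appellSign]
    push_cast
    ring

theorem constantCoeff_qPoch {a : ℤ⟦X⟧} (ha : constantCoeff a = 0) {s : ℕ} (hs : 1 ≤ s) :
    constantCoeff (qPoch a (X ^ s)) = 1 := by
  rw [qPoch, (multipliable_qPoch a hs).map_tprod _
    (PowerSeries.WithPiTopology.continuous_constantCoeff ℤ)]
  convert tprod_one with k
  simp [ha]

theorem isUnit_of_constantCoeff_eq_one {f : ℤ⟦X⟧} (h : constantCoeff f = 1) : IsUnit f := by
  rw [isUnit_iff_constantCoeff, h]
  exact isUnit_one

theorem constantCoeff_qPoch_X_pow {i s : ℕ} (hi : 1 ≤ i) (hs : 1 ≤ s) :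
    constantCoeff (qPoch (X ^ i) (X ^ s)) = 1 :=
  constantCoeff_qPoch (by simp; lia) hs

theorem appellLerchGen_mul_theta :
    appellLerchGen 1 10 * theta (-1) 1 9 = appellLerchSum 1 10 := by
  have hu : IsUnit (qPoch (X ^ 1) (X ^ 10) * qPoch (X ^ (10 - 1)) (X ^ 10) *
      qPoch (X ^ 10) (X ^ 10)) :=
    isUnit_of_constantCoeff_eq_one (by
      rw [map_mul, map_mul, constantCoeff_qPoch_X_pow, constantCoeff_qPoch_X_pow,
        constantCoeff_qPoch_X_pow, mul_one, mul_one] <;> norm_num)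
  rw [theta_neg_eq_prod (by lia), eulerE, appellLerchGen, mul_right_comm]
  simp only [Nat.reduceAdd, Nat.reduceSub] at hu ⊢
  rw [Ring.inverse_mul_cancel _ hu, one_mul]

/-- Taking odd parts is linear over even series, so the even product f(-q, -q^9) f(q, q^9) passes
through, with q² replaced by q. -/
theorem oddPart_appellLerchGen :
    oddPart (appellLerchGen 1 10) * (theta (-1) 1 9 * theta (-1) 5 5) =
      theta 1 1 4 * latticeSum lambdaExp doubleCoeff := by
  rw [← latticeSum_oddExp, ← oddPart_appellLerchSum_mul_theta, ← appellLerchGen_mul_theta,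
    mul_assoc (appellLerchGen 1 10), theta_neg_mul_theta_one_nine, ← oddPart_mul_expand, map_mul,
    expand_theta _ (by lia), expand_theta _ (by lia)]

/-! ### Relations between the products modulo ten -/

theorem theta_zero_eq_two_mul {r : ℕ} (hr : 1 ≤ r) : theta 1 0 r = 2 * theta 1 r (3 * r) := by
  have hb : Function.Bijective fun x : Fin 2 × ℤ =>
      (![fun k => 2 * k, fun k => 1 - 2 * k] : Fin 2 → ℤ → ℤ) x.1 x.2 := by
    constructor
    · rintro ⟨i, k⟩ ⟨i', k'⟩ h
      fin_cases i <;> fin_cases i' <;> simp at h ⊢ <;> lia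
    · intro k
      rcases Int.even_or_odd' k with ⟨u, h | h⟩
      · exact ⟨(0, u), by simp; lia⟩
      · exact ⟨(1, -u), by simp; lia⟩
  rw [theta, latticeSum_partition (locFin_theta (by lia) _) _ hb, Fin.sum_univ_two, two_mul]
  congr 1 <;> refine latticeSum_congr (fun k => by simp only [one_zpow])
    (fun k _ => eq_of_two_mul_eq ?_)
  · simp only [two_mul_thetaExp, Matrix.cons_val_zero]
    push_cast
    ring
  · simp only [two_mul_thetaExp, Matrix.cons_val_one, Matrix.cons_val_fin_one]
    push_cast
    ring

theorem thetaPhi_X_pow (r : ℕ) : thetaPhi (X ^ r) = theta 1 r r := ramanujanTheta_X_pow r r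

theorem two_mul_thetaPsi_X_pow {r : ℕ} (hr : 1 ≤ r) : 2 * thetaPsi (X ^ r) = theta 1 0 r := by
  rw [theta_zero_eq_two_mul hr, thetaPsi, ← pow_mul, mul_comm r 3, ramanujanTheta_X_pow]

theorem constantCoeff_tenPair {i : ℕ} (hi : 1 ≤ i) (hi' : i < 10) :
    constantCoeff (tenPair i) = 1 := by
  rw [tenPair, map_mul, constantCoeff_qPoch_X_pow hi (by lia),
    constantCoeff_qPoch_X_pow (by lia) (by lia), mul_one]

theorem constantCoeff_eulerE {i : ℕ} (hi : 1 ≤ i) : constantCoeff (eulerE i) = 1 :=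
  constantCoeff_qPoch_X_pow hi hi

theorem ne_zero_of_constantCoeff_eq_one {R : Type*} [CommRing R] [Nontrivial R] {f : R⟦X⟧}
    (h : constantCoeff f = 1) : f ≠ 0 := by
  rintro rfl
  simp at h

theorem ofNat_ne_zero (n : ℕ) [n.AtLeastTwo] : (OfNat.ofNat n : ℤ⟦X⟧) ≠ 0 := by
  intro h
  have := congrArg constantCoeff h
  rw [map_ofNat, map_zero] at this
  exact OfNat.ofNat_ne_zero n this

theorem tenPair_ne_zero {i : ℕ} (hi : 1 ≤ i) (hi' : i < 10) : tenPair i ≠ 0 :=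
  ne_zero_of_constantCoeff_eq_one (constantCoeff_tenPair hi hi')

theorem eulerE_ne_zero {i : ℕ} (hi : 1 ≤ i) : eulerE i ≠ 0 :=
  ne_zero_of_constantCoeff_eq_one (constantCoeff_eulerE hi)

theorem qPoch_five_ten_ne_zero : qPoch (X ^ 5) (X ^ 10) ≠ 0 :=
  ne_zero_of_constantCoeff_eq_one (constantCoeff_qPoch_X_pow (by norm_num) (by norm_num))

theorem tenPair_add : tenPair 2 ^ 2 * tenPair 3 * qPoch (X ^ 5) (X ^ 10) ^ 2 =
    tenPair 1 * tenPair 4 * (tenPair 3 * tenPair 4 + X * (tenPair 1 * tenPair 2)) := by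
  have h := theta_one_four_mul_theta_neg_two_three
  have h1 := theta_neg_ten (i := 1) (by norm_num)
  have h2 := theta_neg_ten (i := 2) (by norm_num)
  have h3 := theta_neg_ten (i := 3) (by norm_num)
  have h4 := theta_neg_ten (i := 4) (by norm_num)
  simp only [Nat.reduceSub] at h1 h2 h3 h4
  rw [h1, h2, h3, h4, theta_neg_two_three, pow_one] at h
  refine mul_left_cancel₀ (pow_ne_zero 2 (eulerE_ne_zero (i := 10) (by norm_num))) ?_
  linear_combination tenPair 1 * tenPair 4 * h - tenPair 2 * tenPair 3 *
    qPoch (X ^ 5) (X ^ 10) * eulerE 10 * theta_one_four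

theorem tenPair_sub : tenPair 1 * tenPair 4 ^ 2 * qPoch (X ^ 5) (X ^ 10) ^ 2 =
    tenPair 2 * tenPair 3 * (tenPair 3 * tenPair 4 - X * (tenPair 1 * tenPair 2)) := by
  have h := theta_neg_one_four_mul_theta_two_three
  have h1 := theta_neg_ten (i := 1) (by norm_num)
  have h2 := theta_neg_ten (i := 2) (by norm_num)
  have h3 := theta_neg_ten (i := 3) (by norm_num)
  have h4 := theta_neg_ten (i := 4) (by norm_num)
  simp only [Nat.reduceSub] at h1 h2 h3 h4
  rw [h1, h2, h3, h4, theta_neg_one_four, pow_one] at h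
  refine mul_left_cancel₀ (pow_ne_zero 2 (eulerE_ne_zero (i := 10) (by norm_num))) ?_
  linear_combination tenPair 2 * tenPair 3 * h - tenPair 1 * tenPair 4 *
    qPoch (X ^ 5) (X ^ 10) * eulerE 10 * theta_two_three

theorem tenPair_sq_sub_sq : tenPair 2 * tenPair 4 * qPoch (X ^ 5) (X ^ 10) ^ 4 =
    (tenPair 3 * tenPair 4) ^ 2 - X ^ 2 * (tenPair 1 * tenPair 2) ^ 2 := by
  have hne : tenPair 1 * tenPair 4 * (tenPair 2 * tenPair 3) ≠ 0 :=
    mul_ne_zero (mul_ne_zero (tenPair_ne_zero (by norm_num) (by norm_num))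
      (tenPair_ne_zero (by norm_num) (by norm_num)))
      (mul_ne_zero (tenPair_ne_zero (by norm_num) (by norm_num))
      (tenPair_ne_zero (by norm_num) (by norm_num)))
  refine mul_left_cancel₀ hne ?_
  linear_combination tenPair 1 * tenPair 4 ^ 2 * qPoch (X ^ 5) (X ^ 10) ^ 2 * tenPair_add +
    tenPair 1 * tenPair 4 * (tenPair 3 * tenPair 4 + X * (tenPair 1 * tenPair 2)) * tenPair_sub

theorem theta_zero_one_mul : theta 1 0 1 * (tenPair 1 * tenPair 3 * qPoch (X ^ 5) (X ^ 10)) =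
    2 * (tenPair 2 * tenPair 4 * eulerE 10) := by
  have h := theta_zero_mul_eulerE (r := 1) le_rfl
  rw [mul_one, eulerE_one, eulerE_two] at h
  refine mul_left_cancel₀ (mul_ne_zero (mul_ne_zero (tenPair_ne_zero (i := 2) (by norm_num)
    (by norm_num)) (tenPair_ne_zero (i := 4) (by norm_num) (by norm_num)))
    (eulerE_ne_zero (i := 10) (by norm_num))) ?_
  linear_combination h

theorem theta_zero_five_mul : theta 1 0 5 * qPoch (X ^ 5) (X ^ 10) = 2 * eulerE 10 := by
  have h := theta_zero_mul_eulerE (r := 5) (by norm_num)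
  rw [eulerE_five] at h
  refine mul_left_cancel₀ (eulerE_ne_zero (i := 10) (by norm_num)) ?_
  linear_combination h

theorem tenPair_two_four_sq : (tenPair 2 * tenPair 4) ^ 2 = tenPair 1 * tenPair 3 *
    (qPoch (X ^ 5) (X ^ 10) ^ 4 + X * (tenPair 1 * tenPair 3)) := by
  have h := theta_zero_one_sq
  have h1 := theta_zero_one_mul
  have h5 := theta_zero_five_mul
  have h14 := theta_one_four
  have h23 := theta_two_three
  rw [pow_one] at h
  have hne : 4 * eulerE 10 ^ 2 * (tenPair 2 * tenPair 4) ≠ 0 :=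
    mul_ne_zero (mul_ne_zero (ofNat_ne_zero 4) (pow_ne_zero 2 (eulerE_ne_zero (by norm_num))))
      (mul_ne_zero (tenPair_ne_zero (by norm_num) (by norm_num))
      (tenPair_ne_zero (by norm_num) (by norm_num)))
  refine mul_left_cancel₀ hne ?_
  generalize tenPair 1 = a at *
  generalize tenPair 2 = b at *
  generalize tenPair 3 = c at *
  generalize tenPair 4 = d at *
  generalize qPoch (X ^ 5) (X ^ 10) = e at *
  generalize eulerE 10 = J at *
  linear_combination b * d * (a * c * e) ^ 2 * h -
    b * d * (theta 1 0 1 * (a * c * e) + 2 * (b * d * J)) * h1 +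
    b * d * X * (a * c) ^ 2 * (theta 1 0 5 * e + 2 * J) * h5 +
    4 * a * c * e ^ 2 * (theta 1 2 3 * (b * c)) * h14 + 4 * a * c * e ^ 2 * (b * (e * J)) * h23

theorem theta_neg_one_one : theta (-1) 1 1 =
    tenPair 1 ^ 2 * tenPair 2 * tenPair 3 ^ 2 * tenPair 4 * qPoch (X ^ 5) (X ^ 10) ^ 2 *
      eulerE 10 := by
  have h := theta_neg_self (r := 1) le_rfl
  refine mul_right_cancel₀ (eulerE_ne_zero (i := 1 + 1) (by norm_num)) ?_
  rw [h, eulerE_one]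
  simp only [Nat.reduceAdd]
  rw [eulerE_two]
  ring

theorem theta_neg_five_five : theta (-1) 5 5 = qPoch (X ^ 5) (X ^ 10) ^ 2 * eulerE 10 := by
  have h := theta_neg_self (r := 5) (by norm_num)
  refine mul_right_cancel₀ (eulerE_ne_zero (i := 5 + 5) (by norm_num)) ?_
  rw [h, eulerE_five]
  ring

theorem tenPair_one_three_pow : tenPair 1 ^ 4 * tenPair 2 ^ 2 * tenPair 3 ^ 4 * tenPair 4 ^ 2 *
    qPoch (X ^ 5) (X ^ 10) ^ 4 = qPoch (X ^ 5) (X ^ 10) ^ 4 - 4 * X * (tenPair 1 * tenPair 3) := by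
  have h := theta_neg_one_one_sq
  have h1 := theta_neg_ten (i := 1) (by norm_num)
  have h3 := theta_neg_ten (i := 3) (by norm_num)
  simp only [Nat.reduceSub] at h1 h3
  rw [h1, h3, theta_neg_one_one, theta_neg_five_five, pow_one] at h
  refine mul_left_cancel₀ (pow_ne_zero 2 (eulerE_ne_zero (i := 10) (by norm_num))) ?_
  linear_combination h

theorem constantCoeff_theta_one {i j : ℕ} (hi : 1 ≤ i) (hj : 1 ≤ j) :
    constantCoeff (theta 1 i j) = 1 := by
  rw [theta_one_eq_prod (by lia), map_mul, map_mul,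
    constantCoeff_qPoch (by simp; lia) (by lia), constantCoeff_qPoch (by simp; lia) (by lia),
    constantCoeff_eulerE (by lia), mul_one, mul_one]

/-- Only the square is accessible. With x = φ(q²), y = ψ(q^4), x' = φ(q^10), y' = q²ψ(q^20), one has
(xx' - 4qyy')² = (x² - 4qy²)(x'² - 4qy'²) + 4q(yx' - xy')². The three brackets on the right are
φ(-q)², φ(-q^5)² and E_2 E_10. -/
theorem thetaPhi_mul_sub_thetaPsi_mul : tenPair 2 * tenPair 4 *
    (thetaPhi (X ^ 2) * thetaPhi (X ^ 10) - 4 * X ^ 3 * thetaPsi (X ^ 4) * thetaPsi (X ^ 20)) =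
      eulerE 10 ^ 2 * ((tenPair 3 * tenPair 4) ^ 2 + X ^ 2 * (tenPair 1 * tenPair 2) ^ 2) := by
  have hA := theta_neg_self_sq (r := 1) le_rfl
  have hB := theta_neg_self_sq (r := 5) (by norm_num)
  have hE := theta_level_twenty
  have hp1 := theta_neg_pentagonal (r := 2) (by norm_num)
  have hp2 := theta_neg_pentagonal (r := 10) (by norm_num)
  simp only [Nat.reduceMul] at hA hB hp1 hp2
  rw [theta_neg_one_one, ← two_mul_thetaPsi_X_pow (by norm_num), ← thetaPhi_X_pow, pow_one] at hA
  rw [theta_neg_five_five, ← two_mul_thetaPsi_X_pow (by norm_num), ← thetaPhi_X_pow] at hB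
  rw [hp1, hp2, ← two_mul_thetaPsi_X_pow (by norm_num), ← two_mul_thetaPsi_X_pow (by norm_num),
    ← thetaPhi_X_pow, ← thetaPhi_X_pow, eulerE_two] at hE
  have hE' : thetaPsi (X ^ 4) * thetaPhi (X ^ 10) - X ^ 2 * (thetaPhi (X ^ 2) * thetaPsi (X ^ 20)) =
      tenPair 2 * tenPair 4 * eulerE 10 * eulerE 10 :=
    mul_left_cancel₀ (ofNat_ne_zero 2) (by linear_combination hE)
  have h3 := tenPair_two_four_sq
  have h4 := tenPair_one_three_pow
  have h5 := tenPair_sq_sub_sq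
  have hsq : (tenPair 2 * tenPair 4 * (thetaPhi (X ^ 2) * thetaPhi (X ^ 10) -
      4 * X ^ 3 * thetaPsi (X ^ 4) * thetaPsi (X ^ 20))) ^ 2 =
      (eulerE 10 ^ 2 * ((tenPair 3 * tenPair 4) ^ 2 + X ^ 2 * (tenPair 1 * tenPair 2) ^ 2)) ^ 2 := by
    generalize tenPair 1 = a at *
    generalize tenPair 2 = b at *
    generalize tenPair 3 = c at *
    generalize tenPair 4 = d at *
    generalize qPoch (X ^ 5) (X ^ 10) = e at *
    generalize eulerE 10 = J at *
    generalize thetaPhi (X ^ 2) = p at *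
    generalize thetaPhi (X ^ 10) = p' at *
    generalize thetaPsi (X ^ 4) = s at *
    generalize thetaPsi (X ^ 20) = s' at *
    have k1 : (p * p' - 4 * X ^ 3 * s * s') ^ 2 =
        J ^ 4 * (e ^ 8 - 4 * X * (a * c) * e ^ 4 + 4 * X * (b * d) ^ 2) := by
      linear_combination (-(e ^ 2 * J * (e ^ 2 * J))) * hA - (p * p - X * (2 * s * (2 * s))) * hB +
        4 * X * (s * p' - X ^ 2 * (p * s') + b * d * J * J) * hE' + J ^ 4 * e ^ 4 * h4
    have k2 : (b * d) ^ 2 * (e ^ 8 - 4 * X * (a * c) * e ^ 4 + 4 * X * (b * d) ^ 2) =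
        ((c * d) ^ 2 + X ^ 2 * (a * b) ^ 2) ^ 2 := by
      linear_combination 4 * X * (b * d) ^ 2 * h3 +
        (b * d * e ^ 4 + ((c * d) ^ 2 - X ^ 2 * (a * b) ^ 2)) * h5
    linear_combination (b * d) ^ 2 * k1 + J ^ 4 * k2
  -- Both sides have constant term 1, which excludes the negative root.
  rcases sq_eq_sq_iff_eq_or_eq_neg.mp hsq with h | h
  · exact h
  · have h' := congrArg constantCoeff h
    simp only [map_mul, map_sub, map_neg, map_add, map_pow, constantCoeff_X, thetaPhi_X_pow] at h'
    rw [constantCoeff_tenPair, constantCoeff_tenPair, constantCoeff_tenPair, constantCoeff_tenPair,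
      constantCoeff_eulerE, constantCoeff_theta_one, constantCoeff_theta_one] at h' <;> norm_num at h'
      <;> norm_num

theorem oddPart_mul_tenPair : oddPart (appellLerchGen 1 10) *
    (tenPair 1 ^ 3 * tenPair 4 * qPoch (X ^ 5) (X ^ 10)) = tenPair 2 * eulerE 10 := by
  have h := oddPart_appellLerchGen
  have hL := latticeSum_lambda_mul_theta
  have h14 := theta_one_four
  have h1 := theta_neg_ten (i := 1) (by norm_num)
  simp only [Nat.reduceSub] at h1
  rw [h1, theta_neg_five_five] at h
  rw [h1] at hL
  have hne : eulerE 10 ^ 3 * qPoch (X ^ 5) (X ^ 10) ≠ 0 :=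
    mul_ne_zero (pow_ne_zero 3 (eulerE_ne_zero (by norm_num))) qPoch_five_ten_ne_zero
  refine mul_left_cancel₀ hne ?_
  linear_combination tenPair 1 ^ 2 * tenPair 4 * eulerE 10 * h +
    theta 1 1 4 * tenPair 1 * tenPair 4 * hL + eulerE 10 ^ 3 * h14

/-- In units of J/(a²c²e³) the terms on the right are e^4 - 4qac, 6qac and ((cd)² + q²(ab)²)/(bd).
Substituting e^4 = ((cd)² - q²(ab)²)/(bd) gives the total 2c(cd + qab)/b, which `tenPair_add`
identifies with 2U. -/
theorem two_mul_oddPart_appellLerchGen :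
    2 * oddPart (appellLerchGen 1 10) =
      eulerE 1 ^ 2 * Ring.inverse (eulerE 5) +
      6 * X * (eulerE 2 * eulerE 10 ^ 3) * Ring.inverse (eulerE 1 * eulerE 5 ^ 2) +
      eulerE 2 ^ 2 * Ring.inverse (eulerE 1 ^ 2 * eulerE 5) *
        (thetaPhi (X ^ 2) * thetaPhi (X ^ 10) -
          4 * X ^ 3 * thetaPsi (X ^ 4) * thetaPsi (X ^ 20)) := by
  have c1 := constantCoeff_eulerE (i := 1) le_rfl
  have c5 := constantCoeff_eulerE (i := 5) (by norm_num)
  have i1 := Ring.mul_inverse_cancel _ (isUnit_of_constantCoeff_eq_one c5)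
  have i2 := Ring.mul_inverse_cancel (eulerE 1 * eulerE 5 ^ 2)
    (isUnit_of_constantCoeff_eq_one (by simp [c1, c5]))
  have i3 := Ring.mul_inverse_cancel (eulerE 1 ^ 2 * eulerE 5)
    (isUnit_of_constantCoeff_eq_one (by simp [c1, c5]))
  have r1 := tenPair_add
  have r4 := tenPair_one_three_pow
  have r5 := tenPair_sq_sub_sq
  have r6 := oddPart_mul_tenPair
  have rh := thetaPhi_mul_sub_thetaPsi_mul
  have hne : tenPair 1 * (eulerE 1 ^ 2 * eulerE 5 ^ 2) ≠ 0 :=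
    mul_ne_zero (tenPair_ne_zero le_rfl (by norm_num)) (mul_ne_zero
      (pow_ne_zero 2 (eulerE_ne_zero le_rfl)) (pow_ne_zero 2 (eulerE_ne_zero (by norm_num))))
  refine mul_left_cancel₀ hne ?_
  have key : tenPair 1 * (eulerE 1 ^ 2 * eulerE 5 ^ 2) * (2 * oddPart (appellLerchGen 1 10)) =
      tenPair 1 * (eulerE 1 ^ 4 * eulerE 5 + 6 * X * (eulerE 2 * eulerE 10 ^ 3) * eulerE 1 +
        eulerE 2 ^ 2 * eulerE 5 * (thetaPhi (X ^ 2) * thetaPhi (X ^ 10) -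
          4 * X ^ 3 * thetaPsi (X ^ 4) * thetaPsi (X ^ 20))) := by
    generalize thetaPhi (X ^ 2) * thetaPhi (X ^ 10) -
      4 * X ^ 3 * thetaPsi (X ^ 4) * thetaPsi (X ^ 20) = H at *
    generalize oddPart (appellLerchGen 1 10) = U at *
    rw [eulerE_one, eulerE_five, eulerE_two]
    generalize tenPair 1 = a at *
    generalize tenPair 2 = b at *
    generalize tenPair 3 = c at *
    generalize tenPair 4 = d at *
    generalize qPoch (X ^ 5) (X ^ 10) = e at *
    generalize eulerE 10 = J at *
    linear_combination 2 * b ^ 2 * c ^ 2 * d * e ^ 3 * J ^ 4 * r6 -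
      a * b ^ 2 * d ^ 2 * e * J ^ 5 * r4 - a * b * d * e * J ^ 3 * rh +
      2 * b * c * d * e * J ^ 5 * r1 - a * b * d * e * J ^ 5 * r5
  rw [key]
  linear_combination (-(tenPair 1 * eulerE 1 ^ 4 * eulerE 5)) * i1 -
    tenPair 1 * 6 * X * (eulerE 2 * eulerE 10 ^ 3) * eulerE 1 * i2 -
    tenPair 1 * eulerE 2 ^ 2 * eulerE 5 * (thetaPhi (X ^ 2) * thetaPhi (X ^ 10) -
          4 * X ^ 3 * thetaPsi (X ^ 4) * thetaPsi (X ^ 20)) * i3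

/-! ### The congruence modulo five -/

section
variable {K : Type*} [Field K] [CharP K 5]

/-- The derivation `X d/dX`. -/
def eulerDerivation (K : Type*) [Field K] : Derivation K K⟦X⟧ K⟦X⟧ := (X : K⟦X⟧) • d⁄dX K

theorem eulerDerivation_apply {K : Type*} [Field K] (f : K⟦X⟧) :
    eulerDerivation K f = X * d⁄dX K f := rfl

theorem coeff_eulerDerivation {K : Type*} [Field K] (f : K⟦X⟧) (n : ℕ) :
    coeff n (eulerDerivation K f) = n * coeff n f := by
  rw [eulerDerivation_apply]
  rcases n with _ | n
  · simp
  · rw [coeff_succ_X_mul, coeff_derivative]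
    push_cast
    ring

theorem eulerDerivation_X {K : Type*} [Field K] : eulerDerivation K X = X := by
  rw [eulerDerivation_apply, derivative_X, mul_one]

theorem five_eq_zero : (5 : K⟦X⟧) = 0 := by
  have : (5 : K) = 0 := by exact_mod_cast CharP.cast_eq_zero K 5
  rw [← map_ofNat C 5, this, map_zero]

/-- A solution of `X G' - 2 G = U` in characteristic five, for series related as the theta
products modulo ten. -/
theorem exists_eulerDerivation_sub {a b c d e J U : K⟦X⟧} (ha : constantCoeff a = 1)
    (hb : constantCoeff b = 1) (hc : constantCoeff c = 1) (hd : constantCoeff d = 1)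
    (he : constantCoeff e = 1) (De : eulerDerivation K e = 0) (DJ : eulerDerivation K J = 0)
    (h1 : b ^ 2 * c * e ^ 2 = a * d * (c * d + X * (a * b)))
    (h2 : a * d ^ 2 * e ^ 2 = b * c * (c * d - X * (a * b)))
    (hU : U * (a ^ 3 * d * e) = b * J) :
    ∃ G, eulerDerivation K G - 2 * G = U := by
  have h5 := five_eq_zero (K := K)
  set D := eulerDerivation K with hD
  have inv : ∀ f : K⟦X⟧, constantCoeff f = 1 → ∃ g, f * g = 1 ∧ constantCoeff g = 1 := by
    intro f hf
    have hfu : IsUnit f := by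
      rw [isUnit_iff_constantCoeff, hf]
      exact isUnit_one
    obtain ⟨g, hg⟩ := hfu.exists_right_inv
    refine ⟨g, hg, ?_⟩
    have := congrArg constantCoeff hg
    rwa [map_mul, hf, one_mul, map_one] at this
  obtain ⟨a', ha', ka⟩ := inv a ha
  obtain ⟨b', hb', kb⟩ := inv b hb
  obtain ⟨c', hc', kc⟩ := inv c hc
  obtain ⟨d', hd', kd⟩ := inv d hd
  obtain ⟨e', he', ke⟩ := inv e he
  -- Below, k denotes Xκ, and l = 1/κ.
  obtain ⟨κ, hκ⟩ : ∃ κ, κ = a * b * c' * d' := ⟨_, rfl⟩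
  obtain ⟨l, hl⟩ : ∃ l, l = a' * b' * c * d := ⟨_, rfl⟩
  obtain ⟨R, hR⟩ : ∃ R, R = a * d * b' * c' := ⟨_, rfl⟩
  have hlκ : l * κ = 1 := by
    rw [hl, hκ]
    linear_combination (b * b') * (c * c') * (d * d') * ha' + (c * c') * (d * d') * hb' +
      (d * d') * hc' + hd'
  have habκ : a * b = κ * (c * d) := by
    rw [hκ]
    linear_combination (-(a * b * (d * d'))) * hc' - a * b * hd'
  have hadR : a * d = R * (b * c) := by
    rw [hR]
    linear_combination (-(a * d * (c * c'))) * hb' - a * d * hc'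
  have kκ : constantCoeff κ = 1 := by simp [hκ, ha, hb, kc, kd]
  have kmk : constantCoeff (1 - X * κ) = 1 := by simp
  have kpk : constantCoeff (1 + X * κ) = 1 := by simp
  have km : constantCoeff (1 + X * κ - (X * κ) ^ 2) = 1 := by simp
  have na := ne_zero_of_constantCoeff_eq_one ha
  have nb := ne_zero_of_constantCoeff_eq_one hb
  have nc := ne_zero_of_constantCoeff_eq_one hc
  have nd := ne_zero_of_constantCoeff_eq_one hd
  have ne := ne_zero_of_constantCoeff_eq_one he
  have nκ := ne_zero_of_constantCoeff_eq_one kκ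
  have q1 : b ^ 2 * c * e ^ 2 = a * d * (c * d) * (1 + X * κ) := by
    linear_combination h1 + a * d * X * habκ
  have q2 : a * d ^ 2 * e ^ 2 = b * c * (c * d) * (1 - X * κ) := by
    linear_combination h2 - b * c * X * habκ
  -- The classical relation between the Rogers–Ramanujan continued fraction and Ramanujan's
  -- parameter k.
  have hR5 : R ^ 5 * (1 + X * κ) ^ 2 = κ * (1 - X * κ) ^ 2 := by
    have s1 : b * e ^ 2 = R * c * d * (1 + X * κ) := by
      refine mul_left_cancel₀ (mul_ne_zero nb nc) ?_
      linear_combination q1 + c * d * (1 + X * κ) * hadR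
    have s2 : R * e ^ 2 = c * (1 - X * κ) := by
      refine mul_left_cancel₀ (mul_ne_zero (mul_ne_zero nb nc) nd) ?_
      linear_combination q2 - d * e ^ 2 * hadR
    have s3 : R ^ 2 * d * (1 + X * κ) = (1 - X * κ) * b := by
      refine mul_left_cancel₀ nc ?_
      linear_combination (-R) * s1 + b * s2
    have s4 : R * b ^ 2 = κ * d ^ 2 := by
      refine mul_left_cancel₀ nc ?_
      linear_combination (-b) * hadR + d * habκ
    refine mul_left_cancel₀ (pow_ne_zero 2 nd) ?_
    linear_combination R * (R ^ 2 * d * (1 + X * κ) + (1 - X * κ) * b) * s3 +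
      (1 - X * κ) ^ 2 * s4
  have hDX : D X = X := eulerDerivation_X
  -- Differentiate `hR5`, using D(R^5) = 5R^4 DR = 0. Equivalently, (1 + k - k²) Dk = k(1 - k²).
  have hDκ : D κ * (1 + X * κ - (X * κ) ^ 2) = -(κ * (X * κ)) := by
    have hDR : D (R ^ 5) = 0 := by
      rw [Derivation.leibniz_pow, nsmul_eq_mul]
      push_cast
      rw [h5, zero_mul]
    have h := congrArg D hR5
    simp only [pow_two, Derivation.leibniz, hDR, smul_eq_mul, map_add, map_sub,
      Derivation.map_one_eq_zero, hDX] at h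
    have h' : R ^ 5 * (2 * (1 + X * κ) * (X * κ + X * D κ)) =
        D κ * (1 - X * κ) ^ 2 - 2 * κ * (1 - X * κ) * (X * κ + X * D κ) := by
      linear_combination h
    refine mul_left_cancel₀ (ne_zero_of_constantCoeff_eq_one kmk) ?_
    linear_combination (-(1 + X * κ)) * h' + 2 * (X * κ + X * D κ) * hR5 +
      (1 - X * κ) * (D κ * (X * κ) + κ * (X * κ)) * h5
  have hDl : D l = -(l ^ 2 * D κ) := by
    have h := congrArg D hlκ
    simp only [Derivation.leibniz, smul_eq_mul, Derivation.map_one_eq_zero] at h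
    linear_combination (-D l) * hlκ + l * h
  have hDl' : D l * (1 + X * κ - (X * κ) ^ 2) = l * (X * κ) := by
    linear_combination (1 + X * κ - (X * κ) ^ 2) * hDl - l ^ 2 * hDκ + l * (X * κ) * hlκ
  -- The witness is X²(2k^{-2} - 2k^{-1} - k), an antiderivative twisted by X². The check uses 1 +
  -- 2k - k³ = (1 + k)(1 + k - k²), with -4 = 1.
  have hDG : D (2 * l ^ 2 - 2 * (X * l) - X ^ 3 * κ) - 2 * (2 * l ^ 2 - 2 * (X * l) - X ^ 3 * κ) =
      l ^ 2 * (1 + X * κ) ^ 2 * (1 - X * κ) := by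
    have h : D (2 * l ^ 2 - 2 * (X * l) - X ^ 3 * κ) =
        4 * l * D l - 2 * (X * l) - 2 * (X * D l) - 3 * (X ^ 3 * κ) - X ^ 3 * D κ := by
      simp only [two_mul, pow_succ, pow_zero, one_mul, map_add, map_sub, Derivation.leibniz,
        smul_eq_mul, hDX]
      ring
    refine mul_left_cancel₀ (ne_zero_of_constantCoeff_eq_one km) ?_
    rw [h]
    have e1 : X * l = X * κ * l ^ 2 := by linear_combination (-(X * l)) * hlκ
    have e2 : X ^ 3 * κ = (X * κ) ^ 3 * l ^ 2 := by
      linear_combination (-(X ^ 3 * κ * (l * κ + 1))) * hlκ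
    linear_combination (4 * l - 2 * X) * hDl' - X ^ 3 * hDκ +
      (2 * (1 + X * κ - (X * κ) ^ 2) - 2 * (X * κ)) * e1 +
      (X * κ - (1 + X * κ - (X * κ) ^ 2)) * e2 + l ^ 2 * ((X * κ) ^ 2 - 1) * h5
  have hDe' : D e' = 0 := by
    have h := congrArg D he'
    simp only [Derivation.leibniz, smul_eq_mul, Derivation.map_one_eq_zero, De, mul_zero,
      add_zero] at h
    exact (mul_eq_zero.mp h).resolve_left ne
  have hT : D (J * e' ^ 7) = 0 := by
    rw [Derivation.leibniz, Derivation.leibniz_pow, hDe', DJ]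
    simp
  -- J e^{-7} is a constant for D, so it may multiply the solution. `f3` matches the result with
  -- bJ/(a³de).
  refine ⟨J * e' ^ 7 * (2 * l ^ 2 - 2 * (X * l) - X ^ 3 * κ), ?_⟩
  rw [Derivation.leibniz, hT, smul_eq_mul, smul_zero, add_zero]
  have f1 : a * c ^ 2 * d ^ 3 * ((1 + X * κ) ^ 2 * (1 - X * κ)) = b ^ 3 * e ^ 6 := by
    refine mul_left_cancel₀ (mul_ne_zero (mul_ne_zero na nb)
      (pow_ne_zero 2 (mul_ne_zero nc nd))) ?_
    linear_combination (-(a * c * d ^ 2 * (1 + X * κ) + b ^ 2 * c * e ^ 2)) *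
      (b * c ^ 2 * d * (1 - X * κ)) * q1 - (b ^ 2 * c * e ^ 2) ^ 2 * q2
  have f2 : a * b * l = c * d := by
    linear_combination l * habκ + c * d * hlκ
  have f3 : a ^ 3 * d * e * (l ^ 2 * (1 + X * κ) ^ 2 * (1 - X * κ)) = b * e ^ 7 := by
    refine mul_left_cancel₀ (pow_ne_zero 2 nb) ?_
    linear_combination a * d * e * (1 + X * κ) ^ 2 * (1 - X * κ) * (a * b * l + c * d) * f2 +
      e * f1
  have f4 : e ^ 7 * e' ^ 7 = 1 := by rw [← mul_pow, he', one_pow]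
  refine mul_left_cancel₀ (mul_ne_zero (mul_ne_zero (pow_ne_zero 3 na) nd) ne) ?_
  linear_combination a ^ 3 * d * e * (J * e' ^ 7) * hDG + J * e' ^ 7 * f3 + b * J * f4 - hU

/-- D - 2 acts on the coefficient of X^{5n+2} as multiplication by 5n + 2 - 2. -/
theorem coeff_eq_zero_of_eulerDerivation {G U : K⟦X⟧} (h : eulerDerivation K G - 2 * G = U)
    (n : ℕ) : coeff (5 * n + 2) U = 0 := by
  have h5 : (5 : K) = 0 := by exact_mod_cast CharP.cast_eq_zero K 5
  rw [← h, map_sub, coeff_eulerDerivation, ← map_ofNat C 2, coeff_C_mul]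
  push_cast
  linear_combination n * coeff (5 * n + 2) G * h5

end

instance instFactPrimeFive : Fact (Nat.Prime 5) := ⟨Nat.prime_five⟩

/-- Reduction modulo five. -/
abbrev modFive : ℤ⟦X⟧ →+* (ZMod 5)⟦X⟧ := PowerSeries.map (Int.castRingHom (ZMod 5))

/-- All exponents are multiples of 5, so D multiplies each coefficient by zero. -/
theorem eulerDerivation_modFive_theta (s : ℤˣ) {r r' : ℕ} (h : 1 ≤ r + r') :
    eulerDerivation (ZMod 5) (modFive (theta s (5 * r) (5 * r'))) = 0 := by
  ext n
  rw [coeff_eulerDerivation, coeff_map, map_zero]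
  by_cases hn : 5 ∣ n
  · rw [(ZMod.natCast_eq_zero_iff n 5).mpr hn, zero_mul]
  · rw [theta, coeff_latticeSum (locFin_theta (by lia) _)]
    have : ∀ k : ℤ, ¬ n = (thetaExp ((5 * r : ℕ) : ℤ) ((5 * r' : ℕ) : ℤ) k).toNat := by
      intro k hk
      have h0 := thetaExp_nonneg (5 * r) (5 * r') k
      have h1 : thetaExp ((5 * r : ℕ) : ℤ) ((5 * r' : ℕ) : ℤ) k = 5 * thetaExp r r' k := by
        simp only [thetaExp]
        push_cast
        ring
      lia
    simp only [if_neg (this _), tsum_zero, map_zero, mul_zero]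

theorem modFive_oddPart_coeff (n : ℕ) :
    coeff (5 * n + 2) (modFive (oddPart (appellLerchGen 1 10))) = 0 := by
  have cc : ∀ f : ℤ⟦X⟧, constantCoeff f = 1 → constantCoeff (modFive f) = 1 := by
    intro f hf
    rw [← coeff_zero_eq_constantCoeff_apply, coeff_map, coeff_zero_eq_constantCoeff_apply, hf,
      map_one]
  have ct : ∀ i, 1 ≤ i → i < 10 → constantCoeff (modFive (tenPair i)) = 1 := fun i hi hi' =>
    cc _ (constantCoeff_tenPair hi hi')
  have DJ : eulerDerivation (ZMod 5) (modFive (eulerE 10)) = 0 := by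
    rw [← theta_neg_pentagonal (by norm_num)]
    exact eulerDerivation_modFive_theta (-1) (r := 2) (r' := 4) (by norm_num)
  have D5 : eulerDerivation (ZMod 5) (modFive (eulerE 5)) = 0 := by
    rw [← theta_neg_pentagonal (by norm_num)]
    exact eulerDerivation_modFive_theta (-1) (r := 1) (r' := 2) (by norm_num)
  have cJ : constantCoeff (modFive (eulerE 10)) = 1 := cc _ (constantCoeff_eulerE (by norm_num))
  -- From E_5 = eJ, with D killing E_5 and J.
  have De : eulerDerivation (ZMod 5) (modFive (qPoch (X ^ 5) (X ^ 10))) = 0 := by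
    rw [eulerE_five, map_mul, Derivation.leibniz, DJ, smul_zero, zero_add, smul_eq_mul] at D5
    exact (mul_eq_zero.mp D5).resolve_left (ne_zero_of_constantCoeff_eq_one cJ)
  have h1 := congrArg modFive tenPair_add
  have h2 := congrArg modFive tenPair_sub
  have h3 := congrArg modFive oddPart_mul_tenPair
  simp only [map_mul, map_add, map_sub, map_pow, PowerSeries.map_X] at h1 h2 h3
  obtain ⟨G, hG⟩ := exists_eulerDerivation_sub (ct 1 le_rfl (by norm_num))
    (ct 2 (by norm_num) (by norm_num)) (ct 3 (by norm_num) (by norm_num))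
    (ct 4 (by norm_num) (by norm_num))
    (cc _ (constantCoeff_qPoch_X_pow (by norm_num) (by norm_num))) De DJ h1 h2 h3
  exact coeff_eq_zero_of_eulerDerivation hG n

theorem appellLerchA_modEq_zero (n : ℕ) : appellLerchA 1 10 (10 * n + 5) ≡ 0 [ZMOD 5] := by
  have h := modFive_oddPart_coeff n
  rw [coeff_map, oddPart, coeff_mk, show 2 * (5 * n + 2) + 1 = 10 * n + 5 by ring] at h
  exact (ZMod.intCast_eq_intCast_iff _ _ 5).mp (by simpa [appellLerchA] using h)

end

theorem mainTheorem4 :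
    (∀ n : ℕ, appellLerchA 1 10 (10 * n + 5) ≡ 0 [ZMOD 5]) ∧
    2 * PowerSeries.mk (fun n : ℕ => appellLerchA 1 10 (2 * n + 1)) =
      eulerE 1 ^ 2 * Ring.inverse (eulerE 5) +
      6 * X * (eulerE 2 * eulerE 10 ^ 3) * Ring.inverse (eulerE 1 * eulerE 5 ^ 2) +
      eulerE 2 ^ 2 * Ring.inverse (eulerE 1 ^ 2 * eulerE 5) *
        (thetaPhi (X ^ 2) * thetaPhi (X ^ 10) -
          4 * X ^ 3 * thetaPsi (X ^ 4) * thetaPsi (X ^ 20)) := by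
  exact ⟨appellLerchA_modEq_zero, two_mul_oddPart_appellLerchGen⟩
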